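/- **Theorem 7.1.** Let $\widehat{\mathcal C}$ be the unital $*$-algebra over $\mathbf C$ generated by elements $X_k(\sigma)$, $X_k^*(\sigma)$ and projections $P(\sigma)$, where $k\in\mathbf N$ and $\sigma\subseteq\mathbf N$, subject to the relations $P(\sigma)P(\tau)=P(\sigma\cap\tau)$, $P(\mathbf N)=1$, and $P(\sigma)X_k(\tau)=X_k(\tau)P(\sigma)$, $P(\sigma)X_k^*(\tau)=X_k^*(\tau)P(\sigma)$ whenever $k\in\sigma$. It is a $*$-bialgebra (the filtered $*$-bialgebra) when $X_k(\sigma)$ and $X^*_k(\sigma)$ are $P(\sigma)$-primitive, i.e. $\widehat\Delta(X_k(\sigma))=X_k(\sigma)\otimes P(\sigma)+P(\sigma)\otimes X_k(\sigma)$ and likewise for $X_k^*(\sigma)$, and $P(\sigma)$ is group-like. *The state.* Let $\phi$ be a state on the free $*$-algebra $\mathbf C\langle Y,Y^*\rangle$. Its Boolean extension $\widetilde\phi$ is the linear functional on $\mathbf C\langle Y,Y^*,P\rangle$ ($P$ a projection) determined by $\widetilde\phi(P^{\alpha}a_1Pa_2P\cdots Pa_mP^{\beta})=\phi(a_1)\cdots\phi(a_m)$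 for $a_i\in\mathbf C\langle Y,Y^*\rangle$ and $\alpha,\beta\in\{0,1\}$. Let $\eta:\widehat{\mathcal C}\to\bigotimes_{k\in\mathbf N}\mathbf C\langle Y_k,Y_k^*,P_k\rangle$ be the unital $*$-homomorphism that sends $X_k(\sigma)$ to $Y_k$ (in the $k$-th factor, with $1$ in all other factors) and $P(\sigma)$ to the elementary tensor with $k$-th factor $1$ if $k\in\sigma$ and $P_k$ if $k\notin\sigma$. Put $\widehat\phi=\widetilde\phi^{\otimes\infty}\circ\eta$ and $\widehat\Phi=\widehat\phi^{\otimes\infty}$ on $\widehat{\mathcal C}^{\otimes\infty}$. *The random walks.* For $0\le s\le t<\infty$ and $N\in\mathbf N$ let $N_t=\lfloor tN\rfloor$ and let $\widehat\Delta^N_{s,t}:\widehat{\mathcal C}\to\widehat{\mathcal C}^{\otimes\infty}$ be the unital $*$-homomorphism with $$\widehat\Delta^N_{s,t}(X_k^{\natural}(\sigma))=\sum_{l=N_s+1}^{N_t}P(\sigma)^{\otimes(l-1)}\otimes X_k^{\natural}(\sigma)\otimes P(\sigma)^{\otimes\infty},\qquad \widehat\Delta^N_{s,t}(P(\sigma))=1^{\otimes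 N_s}\otimes P(\sigma)^{\otimes(N_t-N_s)}\otimes1^{\otimes\infty},$$ where $X_k^\natural(\sigma)\in\{X_k(\sigma),X_k^*(\sigma)\}$. *The filtered operators.* Let $\mathcal G$ be a Hilbert space with orthonormal basis $(e_k)_{k\in\mathbf N}$, let $\mathcal H=L^2(\mathbf R^+,\mathcal G)\cong L^2(\mathbf R^+)\otimes\mathcal G$, and let $\Gamma(\mathcal H)$ be the symmetric Fock space over $\mathcal H$, with vacuum vector $\Omega$ and with boson annihilation and creation operators $a(v)$, $a^*(v)$, $v\in\mathcal H$, normalized by $a(u)a^*(v)-a^*(v)a(u)=\langle u,v\rangle$. For $\sigma\subseteq\mathbf N$ let $P^{(\sigma)}$ be the second quantization of the orthogonal projection of $\mathcal H$ onto the closed linear span of $\{f\otimes e_k: f\in L^2(\mathbf R^+),\ k\in\sigma\}$, and put $a^{(\sigma)}(v)=P^{(\sigma)}a(v)$ and $a^{(\sigma)*}(v)=a^*(v)P^{(\sigma)}$ on the finite particle domain. Let $\varphi(T)=\langle\Omega,T\Omega\rangle$. *Statement.* Suppose that $\phi(Y)=0$ and that the only non-vanishing second-order moment of $\phi$ is $\phi(YY^*)=1$,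 i.e. $\phi(YY)=\phi(Y^*Y)=\phi(Y^*Y^*)=0$. Let $n\ge 0$ and, for $i=1,\dots,n$, let $k_i\in\mathbf N$, $\sigma_i\subseteq\mathbf N$, $0\le s_i\le t_i<\infty$, $Z_i=X_{k_i}(\sigma_i)$, $Z_i^*=X^*_{k_i}(\sigma_i)$ and $v_i=\chi_{[s_i,t_i]}\otimes e_{k_i}$. Then, for every choice of $Z_i^\natural\in\{Z_i,Z_i^*\}$, $$\lim_{N\to\infty}N^{-n/2}\,\widehat\Phi\big(\widehat\Delta^N_{s_1,t_1}(Z_1^\natural)\cdots\widehat\Delta^N_{s_n,t_n}(Z_n^\natural)\big)=\varphi\big(a^{(\sigma_1)\natural}(v_1)\cdots a^{(\sigma_n)\natural}(v_n)\big),$$ where $a^{(\sigma_i)\natural}(v_i)$ is $a^{(\sigma_i)}(v_i)$ if $Z_i^\natural=Z_i$ and $a^{(\sigma_i)*}(v_i)$ if $Z_i^\natural=Z_i^*$. -/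

import Mathlib

open Filter Topology MeasureTheory
open scoped ComplexConjugate ComplexOrder TensorProduct

noncomputable section

namespace Filtered

/-! ### *-algebras given by generators and relations -/

/-- The free unital complex algebra on a set of letters. -/
abbrev FreeStarAlgebra (L : Type) : Type := MonoidAlgebra ℂ (FreeMonoid L)

/-- A letter, as an element of the free algebra. -/
def letter {L : Type} (a : L) : FreeStarAlgebra L := MonoidAlgebra.of ℂ _ (FreeMonoid.of a)

/-- The multiplicative and linear extension of a map defined on letters. -/
def freeLift {L : Type} {A : Type*} [Semiring A] [Algebra ℂ A] (f : L → A) :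
    FreeStarAlgebra L →ₐ[ℂ] A :=
  MonoidAlgebra.lift ℂ A (FreeMonoid L) (FreeMonoid.lift f)

@[simp] theorem freeLift_letter {L : Type} {A : Type*} [Semiring A] [Algebra ℂ A] (f : L → A)
    (a : L) : freeLift f (letter a) = f a := by
  simp [freeLift, letter]

theorem freeHom_ext {L : Type} {A : Type*} [Semiring A] [Algebra ℂ A]
    {f g : FreeStarAlgebra L →ₐ[ℂ] A} (h : ∀ a, f (letter a) = g (letter a)) : f = g := by
  apply MonoidAlgebra.algHom_ext'
  · exact FreeMonoid.hom_eq h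
  · ext

theorem freeRingHom_ext {L : Type} {A : Type*} [Semiring A]
    {f g : FreeStarAlgebra L →+* A} (h : ∀ a, f (letter a) = g (letter a))
    (hc : ∀ c : ℂ, f (algebraMap ℂ _ c) = g (algebraMap ℂ _ c)) : f = g := by
  apply MonoidAlgebra.ringHom_ext'
  · ext c; exact hc c
  · exact FreeMonoid.hom_eq h

section FreeStar
variable {L : Type} [InvolutiveStar L]

/-- The involution of the free algebra as a homomorphism to the opposite algebra: it conjugates
scalars, reverses words and applies the involution to each letter. -/
def freeStarHom : FreeStarAlgebra L →+* (FreeStarAlgebra L)ᵐᵒᵖ :=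
  MonoidAlgebra.liftNCRingHom ((algebraMap ℂ (FreeStarAlgebra L)ᵐᵒᵖ).comp (starRingEnd ℂ))
    (FreeMonoid.lift fun a => MulOpposite.op (letter (star a)))
    (fun c w => Algebra.commutes (A := (FreeStarAlgebra L)ᵐᵒᵖ) (conj c)
      (FreeMonoid.lift (fun a => MulOpposite.op (letter (star a))) w))

theorem freeStarHom_letter (a : L) :
    freeStarHom (letter a) = MulOpposite.op (letter (star a)) := by
  refine (MonoidAlgebra.liftNC_single _ _ _ _).trans ?_
  simp [← MonoidAlgebra.one_def]

theorem freeStarHom_algebraMap (c : ℂ) :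
    freeStarHom (algebraMap ℂ (FreeStarAlgebra L) c)
      = MulOpposite.op (algebraMap ℂ (FreeStarAlgebra L) (conj c)) := by
  rw [MonoidAlgebra.coe_algebraMap]
  refine (MonoidAlgebra.liftNC_single _ _ _ _).trans ?_
  simp [MonoidAlgebra.coe_algebraMap]

instance : StarRing (FreeStarAlgebra L) where
  star a := (freeStarHom a).unop
  star_involutive a := by
    have : ((RingEquiv.opOp (FreeStarAlgebra L)).symm.toRingHom.comp
        ((freeStarHom (L := L)).op.comp freeStarHom) : FreeStarAlgebra L →+* _)
        = RingHom.id _ := by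
      apply freeRingHom_ext
      · intro a
        simp [freeStarHom_letter]
      · intro c
        change (freeStarHom (freeStarHom (algebraMap ℂ (FreeStarAlgebra L) c)).unop).unop = _
        rw [freeStarHom_algebraMap, MulOpposite.unop_op, freeStarHom_algebraMap]
        simp
    exact congr($this a)
  star_mul a b := by simp
  star_add a b := by simp

theorem star_letter (a : L) : star (letter a) = letter (star a) := by
  change (freeStarHom (letter a)).unop = _
  simp [freeStarHom_letter]

end FreeStar

section QuotStar
variable {L : Type} [InvolutiveStar L] (r : FreeStarAlgebra L → FreeStarAlgebra L → Prop)
  (hr : ∀ a b, r a b → RingQuot.mkRingHom r (star a) = RingQuot.mkRingHom r (star b))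

/-- The involution induced on the quotient by *-invariant relations. -/
def quotStarHom : RingQuot r →+* (RingQuot r)ᵐᵒᵖ :=
  RingQuot.lift ⟨(RingQuot.mkRingHom r).op.comp freeStarHom, fun a b h =>
    congrArg MulOpposite.op (hr a b h)⟩

theorem quotStarHom_mk (a : FreeStarAlgebra L) :
    quotStarHom r hr (RingQuot.mkRingHom r a)
      = MulOpposite.op (RingQuot.mkRingHom r (star a)) := by
  exact RingQuot.lift_mkRingHom_apply _ _ _

/-- The *-ring structure of a quotient of the free *-algebra by *-invariant relations. -/
abbrev quotStarRing : StarRing (RingQuot r) where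
  star a := (quotStarHom r hr a).unop
  star_involutive a := by
    obtain ⟨a, rfl⟩ := RingQuot.mkRingHom_surjective r a
    change (quotStarHom r hr (quotStarHom r hr _).unop).unop = _
    rw [quotStarHom_mk, MulOpposite.unop_op, quotStarHom_mk, MulOpposite.unop_op, star_star]
  star_mul a b := by simp
  star_add a b := by simp

end QuotStar

/-! ### States -/

/-- A state on a unital complex *-algebra: a normalized positive linear functional. -/
structure State (A : Type*) [Ring A] [StarRing A] [Algebra ℂ A] where
  /-- the underlying linear functional -/
  toLinearMap : A →ₗ[ℂ] ℂ
  map_one : toLinearMap 1 = 1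
  nonneg : ∀ a, 0 ≤ toLinearMap (star a * a)

instance (A : Type*) [Ring A] [StarRing A] [Algebra ℂ A] : CoeFun (State A) fun _ => A → ℂ :=
  ⟨fun φ => φ.toLinearMap⟩

/-! ### The Boolean extension of a state on `ℂ⟨Y, Y*⟩` -/

/-- The letters `Y` and `Y*`. -/
inductive YLetter : Type
  | y
  | yStar

instance : InvolutiveStar YLetter where
  star
    | .y => .yStar
    | .yStar => .y
  star_involutive a := by cases a <;> rfl

/-- The unital *-algebra `ℂ⟨Y, Y*⟩` of polynomials in a noncommuting pair `Y`, `Y*`. -/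
abbrev YPoly : Type := FreeStarAlgebra YLetter

/-- The variable `Y`. -/
def Y : YPoly := letter YLetter.y

/-- The letters `Y`, `Y*` and `P`. -/
inductive YPLetter : Type
  | y
  | yStar
  | p

/-- The relation `P² = P`. -/
inductive YPRel : FreeStarAlgebra YPLetter → FreeStarAlgebra YPLetter → Prop
  | idem : YPRel (letter .p * letter .p) (letter .p)

/-- The algebra `ℂ⟨Y, Y*, P⟩`, the free product (with identified units) of `ℂ⟨Y, Y*⟩` with `ℂ[P]`,
`P` being a projection. -/
abbrev YPPoly : Type := RingQuot YPRel

namespace YPPoly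

/-- The generators of `ℂ⟨Y, Y*, P⟩`. -/
def gen (a : YPLetter) : YPPoly := RingQuot.mkAlgHom ℂ YPRel (letter a)

/-- The projection `P`. -/
def P : YPPoly := gen .p

theorem P_mul_P : P * P = P := by
  rw [P, gen, ← map_mul]
  exact RingQuot.mkAlgHom_rel ℂ YPRel.idem

/-- The inclusion of `ℂ⟨Y, Y*⟩` into `ℂ⟨Y, Y*, P⟩`. -/
def incl : YPoly →ₐ[ℂ] YPPoly :=
  freeLift fun
    | .y => gen .y
    | .yStar => gen .yStar

end YPPoly

/-- The representation of `ℂ⟨Y, Y*, P⟩` on `ℂ⟨Y, Y*⟩` in which `Y`, `Y*` act by multiplication from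
the left and `P` is the projection `a ↦ φ(a) 1` onto the cyclic vector `1`. -/
def booleanRep (φ : State YPoly) : YPPoly →ₐ[ℂ] Module.End ℂ YPoly :=
  RingQuot.liftAlgHom ℂ ⟨freeLift fun
    | .y => LinearMap.mulLeft ℂ Y
    | .yStar => LinearMap.mulLeft ℂ (star Y)
    | .p => φ.toLinearMap.smulRight (1 : YPoly), by
      rintro _ _ ⟨⟩
      ext a
      simp [φ.map_one]⟩

/-- The Boolean extension of the state `φ` to `ℂ⟨Y, Y*, P⟩`, which factorizes at each `P`; see
`booleanExt_word` for its values. -/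
def booleanExt (φ : State YPoly) : YPPoly →ₗ[ℂ] ℂ :=
  φ.toLinearMap ∘ₗ LinearMap.applyₗ (1 : YPoly) ∘ₗ (booleanRep φ).toLinearMap

theorem booleanRep_P (φ : State YPoly) (a : YPoly) : booleanRep φ YPPoly.P a = φ a • 1 := by
  simp [booleanRep, YPPoly.P, YPPoly.gen]

theorem booleanRep_incl (φ : State YPoly) (a b : YPoly) :
    booleanRep φ (YPPoly.incl a) b = a * b := by
  have : (booleanRep φ).comp YPPoly.incl = Algebra.lmul ℂ YPoly := by
    apply freeHom_ext
    rintro (_ | _)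
    · simp [booleanRep, YPPoly.incl, YPPoly.gen, Y]; rfl
    · simp [booleanRep, YPPoly.incl, YPPoly.gen, Y, star_letter]; rfl
  exact congr($this a b)

/-- `φ̃(P^α a₁ P a₂ P ⋯ P aₙ P^β) = φ(a₁) φ(a₂) ⋯ φ(aₙ)` for all `a₁, …, aₙ` in `ℂ⟨Y, Y*⟩`. -/
theorem booleanExt_word (φ : State YPoly) (α β : ℕ) (l : List YPoly) :
    booleanExt φ (YPPoly.P ^ α * ((l.map YPPoly.incl).intersperse YPPoly.P).prod * YPPoly.P ^ β)
      = (l.map φ).prod := by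
  have hpow : ∀ (β : ℕ), booleanRep φ (YPPoly.P ^ β) 1 = 1 := by
    intro β
    induction β with
    | zero => simp
    | succ k ih => simp only [pow_succ, map_mul, Module.End.mul_apply, booleanRep_P, φ.map_one,
        one_smul, ih]
  have hpow' : ∀ (α : ℕ) (a : YPoly), φ (booleanRep φ (YPPoly.P ^ α) a) = φ a := by
    intro α a
    induction α with
    | zero => simp
    | succ k ih => simp only [pow_succ', map_mul, Module.End.mul_apply, booleanRep_P, map_smul,
        φ.map_one, smul_eq_mul, mul_one, ih]
  change φ (booleanRep φ _ 1) = _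
  rw [map_mul, map_mul, Module.End.mul_apply, Module.End.mul_apply, hpow, hpow']
  induction l with
  | nil => simp [φ.map_one]
  | cons a l ih =>
    cases l with
    | nil => simp [booleanRep_incl]
    | cons b l =>
      simp only [List.map_cons, List.intersperse_cons_cons, List.prod_cons, map_mul,
        Module.End.mul_apply, booleanRep_P, booleanRep_incl, map_smul] at ih ⊢
      rw [ih]
      simp [mul_comm]

/-! ### Infinite tensor products -/

/-- The algebraic tensor product of countably many copies of an algebra. -/
abbrev InfTensor (A : Type) [Ring A] [Algebra ℂ A] : Type := ⨂[ℂ] _ : ℕ, A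

open Classical in
theorem prodFunctional_aux (u : ℕ → ℂ) (i : ℕ) (c : ℂ) :
    (if {j | Function.update u i c j ≠ 1}.Finite then ∏ᶠ j, Function.update u i c j else 0)
      = c * (if {j | Function.update u i 1 j ≠ 1}.Finite
          then ∏ᶠ j, Function.update u i 1 j else 0) := by
  have hset : {j | Function.update u i c j ≠ 1}.Finite
      ↔ {j | Function.update u i 1 j ≠ 1}.Finite := by
    constructor <;> intro h <;> refine (h.union (Set.finite_singleton i)).subset ?_ <;>
      intro j hj <;> by_cases hji : j = i <;> simp_all
  simp only [hset]
  split_ifs with h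
  · have hfun : Function.update u i c
        = fun j => Function.update u i 1 j * Function.update (fun _ => (1 : ℂ)) i c j := by
      funext j
      by_cases hji : j = i
      · subst hji; simp
      · simp [hji]
    rw [hfun, finprod_mul_distrib h, finprod_eq_single (Function.update (fun _ => (1 : ℂ)) i c) i, mul_comm]
    · simp
    · intro j hj; simp [hj]
    · refine (Set.finite_singleton i).subset fun j hj => ?_
      by_contra hji
      simp_all
  · simp

open Classical in
/-- The product functional `ψ^{⊗∞}`: on an elementary tensor `⊗ᵢ aᵢ` with `ψ(aᵢ) = 1` for all but
finitely many `i` its value is `∏ᵢ ψ(aᵢ)`. (The infinite tensor product of copies of `(A, ψ)` with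
respect to a set of elements at which `ψ` is `1` is spanned by such tensors; the functional is
extended by `0` to the other elementary tensors.) -/
def prodFunctional {A : Type} [Ring A] [Algebra ℂ A] (ψ : A →ₗ[ℂ] ℂ) : InfTensor A →ₗ[ℂ] ℂ :=
  PiTensorProduct.lift
    { toFun := fun a => if {i | ψ (a i) ≠ 1}.Finite then ∏ᶠ i, ψ (a i) else 0
      map_update_add' := by
        intro inst a i x y
        obtain rfl : inst = instDecidableEqNat := Subsingleton.elim _ _
        have key (z : A) : (fun j => ψ (Function.update a i z j))
            = Function.update (fun j => ψ (a j)) i (ψ z) := by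
          funext j
          by_cases hji : j = i
          · subst hji; simp
          · simp [hji]
        have e (z : A) := (congrArg (fun u : ℕ → ℂ => if {j | u j ≠ 1}.Finite
          then ∏ᶠ j, u j else 0) (key z)).trans (prodFunctional_aux (fun j => ψ (a j)) i (ψ z))
        rw [e, e, e, map_add, add_mul]
      map_update_smul' := by
        intro inst a i c x
        obtain rfl : inst = instDecidableEqNat := Subsingleton.elim _ _
        have key (z : A) : (fun j => ψ (Function.update a i z j))
            = Function.update (fun j => ψ (a j)) i (ψ z) := by
          funext j
          by_cases hji : j = i
          · subst hji; simp
          · simp [hji]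
        have e (z : A) := (congrArg (fun u : ℕ → ℂ => if {j | u j ≠ 1}.Finite
          then ∏ᶠ j, u j else 0) (key z)).trans (prodFunctional_aux (fun j => ψ (a j)) i (ψ z))
        rw [e, e, map_smul, smul_eq_mul, smul_eq_mul, mul_assoc] }

/-! ### The filtered *-bialgebra -/

/-- The letters `X_k(σ)`, `X_k*(σ)` and `P(σ)`, for `k ∈ ℕ` and `σ ⊆ ℕ`. -/
inductive CLetter : Type
  | x (k : ℕ) (σ : Set ℕ)
  | xStar (k : ℕ) (σ : Set ℕ)
  | p (σ : Set ℕ)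

instance : InvolutiveStar CLetter where
  star
    | .x k σ => .xStar k σ
    | .xStar k σ => .x k σ
    | .p σ => .p σ
  star_involutive a := by cases a <;> rfl

/-- The relations of the filtered *-bialgebra. -/
inductive CRel : FreeStarAlgebra CLetter → FreeStarAlgebra CLetter → Prop
  | mul (σ τ : Set ℕ) : CRel (letter (.p σ) * letter (.p τ)) (letter (.p (σ ∩ τ)))
  | univ : CRel (letter (.p Set.univ)) 1
  | comm (k : ℕ) (σ τ : Set ℕ) (h : k ∈ σ) :
      CRel (letter (.p σ) * letter (.x k τ)) (letter (.x k τ) * letter (.p σ))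
  | commStar (k : ℕ) (σ τ : Set ℕ) (h : k ∈ σ) :
      CRel (letter (.p σ) * letter (.xStar k τ)) (letter (.xStar k τ) * letter (.p σ))

/-- The unital *-algebra generated by `X_k(σ)`, `X_k*(σ)` and projections `P(σ)` with
`P(σ) P(τ) = P(σ ∩ τ)`, `P(ℕ) = 1`, and with `P(σ)` commuting with `X_k(τ)`, `X_k*(τ)` for
`k ∈ σ`. -/
abbrev FBialg : Type := RingQuot CRel

theorem star_cRel (a b : FreeStarAlgebra CLetter) (h : CRel a b) :
    RingQuot.mkRingHom CRel (star a) = RingQuot.mkRingHom CRel (star b) := by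
  cases h with
  | mul σ τ =>
    simp only [star_mul, star_letter]
    refine (RingQuot.mkRingHom_rel (CRel.mul τ σ)).trans ?_
    rw [Set.inter_comm]; rfl
  | univ =>
    simp only [star_one, star_letter]
    exact RingQuot.mkRingHom_rel CRel.univ
  | comm k σ τ h =>
    simp only [star_mul, star_letter]
    exact (RingQuot.mkRingHom_rel (CRel.commStar k σ τ h)).symm
  | commStar k σ τ h =>
    simp only [star_mul, star_letter]
    exact (RingQuot.mkRingHom_rel (CRel.comm k σ τ h)).symm

instance : StarRing FBialg := quotStarRing CRel star_cRel

namespace FBialg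

/-- The generators of the filtered *-bialgebra. -/
def gen (a : CLetter) : FBialg := RingQuot.mkAlgHom ℂ CRel (letter a)

/-- The generator `X_k(σ)`. -/
def X (k : ℕ) (σ : Set ℕ) : FBialg := gen (.x k σ)

/-- The generator `P(σ)`. -/
def P (σ : Set ℕ) : FBialg := gen (.p σ)

theorem star_gen (a : CLetter) : star (gen a) = gen (star a) := by
  have h (b : FreeStarAlgebra CLetter) : RingQuot.mkAlgHom ℂ CRel b = RingQuot.mkRingHom CRel b :=
    congr($(RingQuot.mkAlgHom_coe ℂ CRel) b)
  rw [gen, gen, h, h]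
  change (quotStarHom CRel star_cRel _).unop = _
  rw [quotStarHom_mk, star_letter, MulOpposite.unop_op]

theorem star_X (k : ℕ) (σ : Set ℕ) : star (X k σ) = gen (.xStar k σ) := star_gen _

theorem star_P (σ : Set ℕ) : star (P σ) = P σ := star_gen _

theorem P_mul_P (σ τ : Set ℕ) : P σ * P τ = P (σ ∩ τ) := by
  simp only [P, gen, ← map_mul]
  exact RingQuot.mkAlgHom_rel ℂ (CRel.mul σ τ)

theorem P_univ : P Set.univ = 1 := by
  rw [P, gen, ← map_one (RingQuot.mkAlgHom ℂ CRel)]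
  exact RingQuot.mkAlgHom_rel ℂ CRel.univ

theorem commute_P_P (σ τ : Set ℕ) : P σ * P τ = P τ * P σ := by
  rw [P_mul_P, P_mul_P, Set.inter_comm]

theorem P_mul_X {k : ℕ} {σ : Set ℕ} (h : k ∈ σ) (τ : Set ℕ) : P σ * X k τ = X k τ * P σ := by
  simp only [P, X, gen, ← map_mul]
  exact RingQuot.mkAlgHom_rel ℂ (CRel.comm k σ τ h)

theorem P_mul_star_X {k : ℕ} {σ : Set ℕ} (h : k ∈ σ) (τ : Set ℕ) :
    P σ * star (X k τ) = star (X k τ) * P σ := by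
  rw [star_X]
  simp only [P, gen, ← map_mul]
  exact RingQuot.mkAlgHom_rel ℂ (CRel.commStar k σ τ h)

/-- Unital algebra homomorphisms out of the filtered *-bialgebra: the multiplicative and linear
extension of prescribed values `x k σ`, `x' k σ`, `p σ` at `X_k(σ)`, `X_k*(σ)`, `P(σ)`. -/
def lift {A : Type} [Semiring A] [Algebra ℂ A] (x x' : ℕ → Set ℕ → A) (p : Set ℕ → A)
    (mul : ∀ σ τ, p σ * p τ = p (σ ∩ τ)) (univ : p Set.univ = 1)
    (comm : ∀ k σ τ, k ∈ σ → p σ * x k τ = x k τ * p σ)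
    (commStar : ∀ k σ τ, k ∈ σ → p σ * x' k τ = x' k τ * p σ) : FBialg →ₐ[ℂ] A :=
  RingQuot.liftAlgHom ℂ ⟨freeLift fun
    | .x k σ => x k σ
    | .xStar k σ => x' k σ
    | .p σ => p σ, by
      rintro _ _ (⟨σ, τ⟩ | _ | ⟨k, σ, τ, h⟩ | ⟨k, σ, τ, h⟩)
      · simpa using mul σ τ
      · simpa using univ
      · simpa using comm k σ τ h
      · simpa using commStar k σ τ h⟩

section lift
variable {A : Type} [Semiring A] [Algebra ℂ A] (x x' : ℕ → Set ℕ → A) (p : Set ℕ → A)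
    (mul : ∀ σ τ, p σ * p τ = p (σ ∩ τ)) (univ : p Set.univ = 1)
    (comm : ∀ k σ τ, k ∈ σ → p σ * x k τ = x k τ * p σ)
    (commStar : ∀ k σ τ, k ∈ σ → p σ * x' k τ = x' k τ * p σ)

@[simp] theorem lift_X (k : ℕ) (σ : Set ℕ) :
    lift x x' p mul univ comm commStar (X k σ) = x k σ := by
  simp [lift, X, gen]

@[simp] theorem lift_star_X (k : ℕ) (σ : Set ℕ) :
    lift x x' p mul univ comm commStar (star (X k σ)) = x' k σ := by
  rw [star_X]
  simp [lift, gen]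

@[simp] theorem lift_P (σ : Set ℕ) : lift x x' p mul univ comm commStar (P σ) = p σ := by
  simp [lift, P, gen]

end lift

theorem algHom_ext {A : Type} [Semiring A] [Algebra ℂ A] {f g : FBialg →ₐ[ℂ] A}
    (hX : ∀ k σ, f (X k σ) = g (X k σ)) (hX' : ∀ k σ, f (star (X k σ)) = g (star (X k σ)))
    (hP : ∀ σ, f (P σ) = g (P σ)) : f = g := by
  apply RingQuot.ringQuot_ext'
  apply freeHom_ext
  rintro (⟨k, σ⟩ | ⟨k, σ⟩ | σ)
  · exact hX k σ
  · have := hX' k σ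
    rw [star_X] at this
    exact this
  · exact hP σ

/-- The filtered coproduct: `X_k(σ)` and `X_k*(σ)` are `P(σ)`-primitive, `P(σ)` is group-like. -/
def comulHom : FBialg →ₐ[ℂ] FBialg ⊗[ℂ] FBialg :=
  lift (fun k σ => X k σ ⊗ₜ P σ + P σ ⊗ₜ X k σ)
    (fun k σ => star (X k σ) ⊗ₜ P σ + P σ ⊗ₜ star (X k σ)) (fun σ => P σ ⊗ₜ P σ)
    (fun σ τ => by simp [P_mul_P])
    (by simp [P_univ, Algebra.TensorProduct.one_def])
    (fun k σ τ h => by simp [mul_add, add_mul, P_mul_X h, commute_P_P σ τ])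
    (fun k σ τ h => by simp [mul_add, add_mul, P_mul_star_X h, commute_P_P σ τ])

/-- The counit: `X_k(σ), X_k*(σ) ↦ 0`, `P(σ) ↦ 1`. -/
def counitHom : FBialg →ₐ[ℂ] ℂ :=
  lift (fun _ _ => 0) (fun _ _ => 0) (fun _ => 1) (by simp) (by simp) (by simp) (by simp)

instance : Bialgebra ℂ FBialg :=
  Bialgebra.ofAlgHom comulHom counitHom
    (by
      apply algHom_ext
      · intro k σ
        simp [comulHom, TensorProduct.add_tmul, TensorProduct.tmul_add, add_assoc]
      · intro k σ
        simp [comulHom, TensorProduct.add_tmul, TensorProduct.tmul_add, add_assoc]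
      · intro σ
        simp [comulHom])
    (by
      apply algHom_ext
      · intro k σ; simp [comulHom, counitHom]
      · intro k σ; simp [comulHom, counitHom]
      · intro σ; simp [comulHom, counitHom])
    (by
      apply algHom_ext
      · intro k σ; simp [comulHom, counitHom]
      · intro k σ; simp [comulHom, counitHom]
      · intro σ; simp [comulHom, counitHom])

end FBialg


/-! ### The state and the random walks on the filtered *-bialgebra -/

open Classical in
/-- The elementary tensor with `1` in the colors `k ∈ σ` and `P` in the colors `k ∉ σ`. -/
def filterTensor (σ : Set ℕ) : InfTensor YPPoly :=
  PiTensorProduct.tprod ℂ fun k => if k ∈ σ then 1 else YPPoly.P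

/-- The elementary tensor with `a` in the color `k` and `1` in all other colors. -/
def colorTensor (k : ℕ) (a : YPPoly) : InfTensor YPPoly :=
  PiTensorProduct.tprod ℂ (Function.update (fun _ => 1) k a)

theorem filterTensor_mul_colorTensor {k : ℕ} {σ : Set ℕ} (h : k ∈ σ) (a : YPPoly) :
    filterTensor σ * colorTensor k a = colorTensor k a * filterTensor σ := by
  rw [filterTensor, colorTensor, PiTensorProduct.tprod_mul_tprod, PiTensorProduct.tprod_mul_tprod]
  congr 1
  funext j
  by_cases hj : j = k
  · subst hj; simp [h]
  · simp [hj]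

/-- The homomorphism `η` from the filtered *-bialgebra to `⨂ₖ ℂ⟨Y_k, Y_k*, P_k⟩` which sends
`X_k(σ)` to `Y_k`, `X_k*(σ)` to `Y_k*`, and `P(σ)` to the product of the `P_k` with `k ∉ σ`. -/
def eta : FBialg →ₐ[ℂ] InfTensor YPPoly :=
  FBialg.lift (fun k _ => colorTensor k (YPPoly.incl Y))
    (fun k _ => colorTensor k (YPPoly.incl (star Y))) filterTensor
    (fun σ τ => by
      rw [filterTensor, filterTensor, filterTensor, PiTensorProduct.tprod_mul_tprod]
      congr 1
      funext j
      by_cases h1 : j ∈ σ <;> by_cases h2 : j ∈ τ <;> simp [h1, h2, YPPoly.P_mul_P])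
    (by simp only [filterTensor, Set.mem_univ, if_true]; rfl)
    (fun _ _ _ h => filterTensor_mul_colorTensor h _)
    (fun _ _ _ h => filterTensor_mul_colorTensor h _)

/-- The state `φ̂ = φ̃^{⊗∞} ∘ η` on the filtered *-bialgebra. -/
def phiHat (φ : State YPoly) : FBialg →ₗ[ℂ] ℂ :=
  prodFunctional (booleanExt φ) ∘ₗ eta.toLinearMap

/-- The product state `Φ̂ = φ̂^{⊗∞}` on the infinite tensor product of copies of the filtered
*-bialgebra. -/
def PhiHat (φ : State YPoly) : InfTensor FBialg →ₗ[ℂ] ℂ := prodFunctional (phiHat φ)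

/-- `P ⊗ ⋯ ⊗ P ⊗ a ⊗ P ⊗ P ⊗ ⋯`, with `a` in the factor of index `l` and `P = P(σ)`. Factors are
numbered from `0`, so that `a` has `l` factors to its left. -/
def siteTensor (l : ℕ) (a : FBialg) (σ : Set ℕ) : InfTensor FBialg :=
  PiTensorProduct.tprod ℂ (Function.update (fun _ => FBialg.P σ) l a)

/-- `1^{⊗ m} ⊗ P(σ)^{⊗ (n - m)} ⊗ 1^{⊗ ∞}`. -/
def blockTensor (m n : ℕ) (σ : Set ℕ) : InfTensor FBialg :=
  PiTensorProduct.tprod ℂ fun l => if l ∈ Finset.Ico m n then FBialg.P σ else 1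

theorem blockTensor_mul_siteTensor (m n : ℕ) (σ τ : Set ℕ) (a : FBialg)
    (h : FBialg.P σ * a = a * FBialg.P σ) (l : ℕ) :
    blockTensor m n σ * siteTensor l a τ = siteTensor l a τ * blockTensor m n σ := by
  rw [blockTensor, siteTensor, PiTensorProduct.tprod_mul_tprod, PiTensorProduct.tprod_mul_tprod]
  congr 1
  funext j
  by_cases hj : j = l
  · subst hj; by_cases hm : j ∈ Finset.Ico m n <;> simp only [Pi.mul_apply, hm, if_true, if_false] <;> simp [h]
  · by_cases hm : j ∈ Finset.Ico m n <;> simp only [Pi.mul_apply, hm, if_true, if_false] <;>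
      simp [hj, FBialg.commute_P_P σ τ]

/-- The random walk with continuous time: the unital homomorphism `Δ̂^N_{s,t}` given by
`X_k^♮(σ) ↦ ∑_{N_s < l ≤ N_t} P(σ)^{⊗ (l - 1)} ⊗ X_k^♮(σ) ⊗ P(σ)^{⊗ ∞}` and
`P(σ) ↦ 1^{⊗ N_s} ⊗ P(σ)^{⊗ (N_t - N_s)} ⊗ 1^{⊗ ∞}`, where `N_t` is the integer part of `t N`. -/
def randomWalk (N : ℕ) (s t : ℝ) : FBialg →ₐ[ℂ] InfTensor FBialg :=
  FBialg.lift
    (fun k σ => ∑ l ∈ Finset.Ico ⌊s * N⌋₊ ⌊t * N⌋₊, siteTensor l (FBialg.X k σ) σ)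
    (fun k σ => ∑ l ∈ Finset.Ico ⌊s * N⌋₊ ⌊t * N⌋₊, siteTensor l (star (FBialg.X k σ)) σ)
    (fun σ => blockTensor ⌊s * N⌋₊ ⌊t * N⌋₊ σ)
    (fun σ τ => by
      rw [blockTensor, blockTensor, blockTensor, PiTensorProduct.tprod_mul_tprod]
      congr 1
      funext j
      by_cases hm : j ∈ Finset.Ico ⌊s * N⌋₊ ⌊t * N⌋₊ <;>
        simp only [Pi.mul_apply, hm, if_true, if_false, FBialg.P_mul_P, mul_one])
    (by simp only [blockTensor, FBialg.P_univ, ite_self]; rfl)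
    (fun k σ τ h => by
      rw [Finset.mul_sum, Finset.sum_mul]
      exact Finset.sum_congr rfl fun l _ =>
        blockTensor_mul_siteTensor _ _ _ _ _ (FBialg.P_mul_X h τ) l)
    (fun k σ τ h => by
      rw [Finset.mul_sum, Finset.sum_mul]
      exact Finset.sum_congr rfl fun l _ =>
        blockTensor_mul_siteTensor _ _ _ _ _ (FBialg.P_mul_star_X h τ) l)

/-! ### The symmetric Fock space -/

section Fock
variable (H : Type*) [NormedAddCommGroup H] [InnerProductSpace ℂ H]

/-- The finite particle domain of the symmetric Fock space over `H`, i.e. the linear span of the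
symmetric products of vectors of `H`, the product of the empty family being the vacuum `1`. The
normalization is such that `v₁ ∘ ⋯ ∘ vₙ` is the product of the `vᵢ` in the symmetric algebra divided
by `√(n!)`; see `symProd`. -/
def FockDomain : Type _ := SymmetricAlgebra ℂ H

instance : CommRing (FockDomain H) := inferInstanceAs (CommRing (SymmetricAlgebra ℂ H))

instance : Algebra ℂ (FockDomain H) := inferInstanceAs (Algebra ℂ (SymmetricAlgebra ℂ H))

variable {H}

namespace FockDomain

/-- A one-particle vector. -/
def ι : H →ₗ[ℂ] FockDomain H := SymmetricAlgebra.ι ℂ H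

/-- The extension of a linear map on one-particle vectors to an algebra homomorphism. -/
def lift {A : Type*} [CommRing A] [Algebra ℂ A] (f : H →ₗ[ℂ] A) : FockDomain H →ₐ[ℂ] A :=
  SymmetricAlgebra.lift f

@[simp] theorem lift_ι {A : Type*} [CommRing A] [Algebra ℂ A] (f : H →ₗ[ℂ] A) (v : H) :
    lift f (ι v) = f v := SymmetricAlgebra.lift_ι_apply f v

theorem hom_ext {A : Type*} [CommRing A] [Algebra ℂ A] {f g : FockDomain H →ₐ[ℂ] A}
    (h : ∀ v, f (ι v) = g (ι v)) : f = g :=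
  SymmetricAlgebra.algHom_ext (LinearMap.ext h)

theorem induct {p : FockDomain H → Prop} (x : FockDomain H) (one : p 1)
    (smul : ∀ (c : ℂ) x, p x → p (c • x)) (add : ∀ x y, p x → p y → p (x + y))
    (mul : ∀ v x, p x → p (ι v * x)) : p x := by
  have key : ∀ a b : FockDomain H, p b → p (a * b) := by
    intro a
    refine SymmetricAlgebra.induction (R := ℂ) (M := H) (motive := fun a : FockDomain H => ∀ b, p b → p (a * b))
      ?_ ?_ ?_ ?_ a
    · intro c b hb
      have := smul c b hb
      rwa [Algebra.smul_def] at this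
    · intro v b hb
      exact mul v b hb
    · intro a b ha hb c hc
      have := ha _ (hb _ hc)
      rwa [← mul_assoc (G := FockDomain H) a b c] at this
    · intro a b ha hb c hc
      have := add _ _ (ha _ hc) (hb _ hc)
      rwa [← add_mul (R := FockDomain H) a b c] at this
  simpa using key x 1 one

/-- The component of a vector along the vacuum. -/
def vacCoeff : FockDomain H →ₐ[ℂ] ℂ := lift 0

/-- `x ↦ x + ε a(f) x`, with values in the dual numbers. -/
def annAux (f : H) : FockDomain H →ₐ[ℂ] DualNumber (FockDomain H) :=
  lift ((TrivSqZeroExt.inlAlgHom ℂ (FockDomain H) (FockDomain H)).toLinearMap ∘ₗ ι +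
    ((TrivSqZeroExt.inrHom (FockDomain H) (FockDomain H)).restrictScalars ℂ) ∘ₗ
      (Algebra.linearMap ℂ (FockDomain H)) ∘ₗ (innerₛₗ ℂ f))

/-- The boson annihilation operator `a(f)`: the derivation with `a(f) v = ⟨f, v⟩` for `v ∈ H`. -/
def ann (f : H) : Module.End ℂ (FockDomain H) :=
  ((TrivSqZeroExt.sndHom (FockDomain H) (FockDomain H)).restrictScalars ℂ) ∘ₗ
    (annAux f).toLinearMap

/-- The boson creation operator `a*(f)`. -/
def create (f : H) : Module.End ℂ (FockDomain H) := LinearMap.mulLeft ℂ (ι f)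

theorem create_apply (f : H) (x : FockDomain H) : create f x = ι f * x := rfl

theorem fst_annAux (f : H) (x : FockDomain H) : (annAux f x).fst = x := by
  have : (TrivSqZeroExt.fstHom ℂ (FockDomain H) (FockDomain H)).comp (annAux f)
      = AlgHom.id ℂ (FockDomain H) := by
    apply hom_ext
    intro v
    simp [annAux]
  exact congr($this x)

theorem ann_ι (f v : H) : ann f (ι v) = algebraMap ℂ _ (inner ℂ f v) := by
  simp [ann, annAux, Algebra.algebraMap_eq_smul_one]

theorem ann_one (f : H) : ann f (1 : FockDomain H) = 0 := by
  simp [ann]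

theorem ann_mul (f : H) (x y : FockDomain H) : ann f (x * y) = ann f x * y + x * ann f y := by
  simp [ann, fst_annAux, mul_comm, add_comm]

theorem ann_ι_mul (f v : H) (x : FockDomain H) :
    ann f (ι v * x) = (inner ℂ f v : ℂ) • x + ι v * ann f x := by
  rw [ann_mul, ann_ι, Algebra.smul_def]

theorem ann_comm (f g : H) (x : FockDomain H) : ann f (ann g x) = ann g (ann f x) := by
  induction x using induct with
  | one => simp [ann_one]
  | smul c x h => simp [h]
  | add x y hx hy => simp [hx, hy]
  | mul v x h => simp only [ann_ι_mul, map_add, map_smul, h]; abel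

theorem ann_add (f g : H) (x : FockDomain H) : ann (f + g) x = ann f x + ann g x := by
  induction x using induct with
  | one => simp [ann_one]
  | smul c x h => simp [h]
  | add x y hx hy => simp only [map_add, hx, hy]; abel
  | mul v x h => simp only [ann_ι_mul, h, inner_add_left, add_smul, mul_add]; abel

theorem ann_smul (c : ℂ) (f : H) (x : FockDomain H) : ann (c • f) x = conj c • ann f x := by
  induction x using induct with
  | one => simp [ann_one]
  | smul d x h => rw [map_smul, map_smul, h, smul_comm]
  | add x y hx hy => simp only [map_add, hx, hy, smul_add]
  | mul v x h => simp only [ann_ι_mul, h, inner_smul_left, mul_smul, smul_add,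
      Algebra.mul_smul_comm]

/-- Conjugate linear functionals on the finite particle domain. -/
abbrev ConjDual (H : Type*) [NormedAddCommGroup H] [InnerProductSpace ℂ H] : Type _ :=
  FockDomain H →ₛₗ[starRingEnd ℂ] ℂ

/-- The transpose of `a(f)` on conjugate linear functionals, which is linear in `f`. -/
def annDual : H →ₗ[ℂ] Module.End ℂ (ConjDual H) where
  toFun f :=
    { toFun := fun θ => θ.comp (ann f)
      map_add' := fun _ _ => rfl
      map_smul' := fun _ _ => rfl }
  map_add' f g := by
    ext θ x
    simp [ann_add]
  map_smul' c f := by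
    ext θ x
    simp [ann_smul]

theorem annDual_comm : ∀ S ∈ Set.range (annDual (H := H)), ∀ T ∈ Set.range (annDual (H := H)),
    S * T = T * S := by
  rintro _ ⟨f, rfl⟩ _ ⟨g, rfl⟩
  ext θ x
  exact congrArg θ (ann_comm g f x)

/-- The commutative algebra generated by the transposes of the annihilation operators. -/
abbrev AnnAlg (H : Type*) [NormedAddCommGroup H] [InnerProductSpace ℂ H] : Type _ :=
  Algebra.adjoin ℂ (Set.range (annDual (H := H)))

instance : IsMulCommutative (AnnAlg H) := Algebra.isMulCommutative_adjoin ℂ annDual_comm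

open scoped IsMulCommutative in
/-- The extension of `annDual` to products. -/
def annProd : FockDomain H →ₐ[ℂ] Module.End ℂ (ConjDual H) :=
  (Algebra.adjoin ℂ (Set.range (annDual (H := H)))).val.comp
    (lift (A := AnnAlg H) (annDual.codRestrict
      (Subalgebra.toSubmodule (Algebra.adjoin ℂ (Set.range (annDual (H := H)))))
      fun f => Algebra.subset_adjoin ⟨f, rfl⟩))

theorem annProd_ι (f : H) : annProd (ι f) = annDual f := by
  simp [annProd]
  rfl

/-- The conjugate of the vacuum component. -/
def vacConj : ConjDual H :=
  { toFun := fun x => conj (vacCoeff x)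
    map_add' := fun x y => by simp
    map_smul' := fun c x => by simp }

/-- The scalar product of the symmetric Fock space on the finite particle domain; it is determined
by `⟨1, 1⟩ = 1`, `a(f) 1 = 0` and the fact that `a*(f)` is adjoint to `a(f)`. See
`inner_symProd` and `inner_symProd_of_ne` for its values. -/
instance : Inner ℂ (FockDomain H) := ⟨fun x y => annProd y vacConj x⟩

theorem inner_def (x y : FockDomain H) : inner ℂ x y = annProd y vacConj x := rfl

theorem inner_add_r (x y z : FockDomain H) :
    inner ℂ x (y + z) = inner ℂ x y + inner ℂ x z := by
  simp [inner_def]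

theorem inner_smul_r (c : ℂ) (x y : FockDomain H) : inner ℂ x (c • y) = c * inner ℂ x y := by
  simp [inner_def]

theorem inner_add_l (x y z : FockDomain H) :
    inner ℂ (x + y) z = inner ℂ x z + inner ℂ y z := by
  simp [inner_def]

theorem inner_smul_l (c : ℂ) (x y : FockDomain H) :
    inner ℂ (c • x) y = conj c * inner ℂ x y := by
  simp [inner_def]

theorem inner_ι_mul_r (f : H) (x y : FockDomain H) :
    inner ℂ x (ι f * y) = inner ℂ (ann f x) y := by
  rw [inner_def, inner_def, map_mul, annProd_ι]
  rfl

theorem inner_one_r (x : FockDomain H) : inner ℂ x 1 = conj (vacCoeff x) := by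
  simp [inner_def]
  rfl

theorem inner_ι_mul_l (f : H) (x y : FockDomain H) :
    inner ℂ (ι f * x) y = inner ℂ x (ann f y) := by
  induction y using induct generalizing x with
  | one => rw [ann_one, ← zero_smul ℂ (0 : FockDomain H), inner_smul_r, inner_one_r]; simp [vacCoeff]
  | smul c y h => rw [map_smul, inner_smul_r, inner_smul_r, h]
  | add y z hy hz => rw [map_add, inner_add_r, inner_add_r, hy, hz]
  | mul g y h =>
    rw [inner_ι_mul_r, ann_ι_mul, ann_ι_mul, inner_add_l, inner_add_r, inner_smul_l, inner_smul_r,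
      inner_ι_mul_r, h, inner_conj_symm]

theorem inner_one_l (y : FockDomain H) : inner ℂ 1 y = vacCoeff y := by
  induction y using induct with
  | one => rw [inner_one_r]; simp
  | smul c y h => rw [inner_smul_r, h, map_smul, smul_eq_mul]
  | add y z hy hz => rw [inner_add_r, hy, hz, map_add]
  | mul g y h =>
    rw [inner_ι_mul_r, ann_one, ← zero_smul ℂ (0 : FockDomain H), inner_smul_l]
    simp [vacCoeff]

theorem inner_symm (x y : FockDomain H) : conj (inner ℂ y x) = (inner ℂ x y : ℂ) := by
  induction x using induct generalizing y with
  | one => rw [inner_one_l, inner_one_r, Complex.conj_conj]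
  | smul c x h => rw [inner_smul_r, inner_smul_l, map_mul, h]
  | add x z hx hz => rw [inner_add_r, inner_add_l, map_add, hx, hz]
  | mul g x h => rw [inner_ι_mul_l, inner_ι_mul_r, h]

section Positivity
variable {n : ℕ} {e : Fin n → H}

/-- Polynomials in finitely many one-particle vectors. -/
def poly (e : Fin n → H) : MvPolynomial (Fin n) ℂ →ₐ[ℂ] FockDomain H :=
  MvPolynomial.aeval fun i => ι (e i)

theorem ann_poly (he : Orthonormal ℂ e) (i : Fin n) (p : MvPolynomial (Fin n) ℂ) :
    ann (e i) (poly e p) = poly e (MvPolynomial.pderiv i p) := by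
  induction p using MvPolynomial.induction_on with
  | C c =>
    rw [MvPolynomial.pderiv_C, map_zero, MvPolynomial.C_eq_smul_one, map_smul, map_one, map_smul,
      ann_one, smul_zero]
  | add p q hp hq => simp only [map_add, hp, hq]
  | mul_X p j hp =>
    rw [map_mul, ann_mul, hp, MvPolynomial.pderiv_mul, map_add, map_mul, map_mul]
    congr 2
    rw [MvPolynomial.pderiv_X, poly, MvPolynomial.aeval_X, ann_ι, orthonormal_iff_ite.mp he]
    by_cases hij : i = j
    · subst hij; simp
    · simp [hij, Ne.symm hij]

theorem inner_monomial (he : Orthonormal ℂ e) (s : Fin n →₀ ℕ) (q : MvPolynomial (Fin n) ℂ) :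
    inner ℂ (poly e (MvPolynomial.monomial s 1)) (poly e q)
      = (∏ i, (s i).factorial : ℕ) * MvPolynomial.coeff s q := by
  induction hd : s.degree generalizing s q with
  | zero =>
    obtain rfl : s = 0 := by rwa [Finsupp.degree_eq_zero_iff] at hd
    have : (vacCoeff (H := H)).comp (poly e) = MvPolynomial.aeval (fun _ => (0 : ℂ)) := by
      ext i
      simp [poly, vacCoeff]
    have h2 : (vacCoeff (H := H)) (poly e q) = MvPolynomial.aeval (fun _ => (0 : ℂ)) q :=
      congr($this q)
    have h1 : (MvPolynomial.monomial (0 : Fin n →₀ ℕ)) (1 : ℂ) = 1 := rfl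
    rw [h1, map_one, inner_one_l, h2]
    simp [MvPolynomial.aeval_def, MvPolynomial.constantCoeff_eq]
  | succ d ih =>
    obtain ⟨i, hi⟩ : ∃ i, s i ≠ 0 := by
      by_contra! h
      have : s = 0 := Finsupp.ext h
      simp [this] at hd
    obtain ⟨t, rfl⟩ : ∃ t, s = Finsupp.single i 1 + t :=
      ⟨s - Finsupp.single i 1, (add_tsub_cancel_of_le (by
        rw [Finsupp.single_le_iff]; omega)).symm⟩
    have hm : (MvPolynomial.monomial (Finsupp.single i 1 + t)) (1 : ℂ)
        = MvPolynomial.X i * MvPolynomial.monomial t 1 := by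
      rw [MvPolynomial.X, MvPolynomial.monomial_mul, one_mul]
    have hX : poly e (MvPolynomial.X i) = ι (e i) := by simp [poly]
    rw [hm, map_mul, hX, inner_ι_mul_l, ann_poly he, ih t]
    · rw [MvPolynomial.coeff_pderiv, add_comm t]
      have : (∏ j, ((Finsupp.single i 1 + t : Fin n →₀ ℕ) j).factorial)
          = (t i + 1) * ∏ j, (t j).factorial := by
        rw [← Finset.mul_prod_erase _ _ (Finset.mem_univ i),
          ← Finset.mul_prod_erase Finset.univ (fun j => (t j).factorial) (Finset.mem_univ i),
          ← mul_assoc]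
        congr 1
        · simp [add_comm 1 (t i), Nat.factorial_succ]
        · refine Finset.prod_congr rfl fun j hj => ?_
          simp [(Finset.ne_of_mem_erase hj).symm]
      rw [this]
      push_cast
      ring
    · simp [map_add] at hd
      omega

theorem inner_poly (he : Orthonormal ℂ e) (p q : MvPolynomial (Fin n) ℂ) :
    inner ℂ (poly e p) (poly e q) = ∑ s ∈ p.support, (∏ i, (s i).factorial : ℕ) *
      (conj (MvPolynomial.coeff s p) * MvPolynomial.coeff s q) := by
  have hsum : ∀ (t : Finset (Fin n →₀ ℕ)) (u : (Fin n →₀ ℕ) → FockDomain H) (y : FockDomain H),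
      inner ℂ (∑ s ∈ t, u s) y = ∑ s ∈ t, (inner ℂ (u s) y : ℂ) := by
    intro t u y
    simp [inner_def]
  conv_lhs => rw [p.as_sum]
  rw [map_sum, hsum]
  refine Finset.sum_congr rfl fun s _ => ?_
  have : (MvPolynomial.monomial s) (MvPolynomial.coeff s p)
      = MvPolynomial.coeff s p • MvPolynomial.monomial s (1 : ℂ) := by
    simp [MvPolynomial.smul_monomial]
  rw [this, map_smul, inner_smul_l, inner_monomial he]
  ring

theorem exists_poly (x : FockDomain H) :
    ∃ (n : ℕ) (e : Fin n → H), Orthonormal ℂ e ∧ ∃ p, poly e p = x := by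
  obtain ⟨V, hV, hx⟩ : ∃ V : Submodule ℂ H, FiniteDimensional ℂ V ∧
      x ∈ Algebra.adjoin ℂ (ι '' (V : Set H)) := by
    have mono {V W : Submodule ℂ H} (h : V ≤ W) :
        Algebra.adjoin ℂ (ι '' (V : Set H)) ≤ Algebra.adjoin ℂ (ι '' (W : Set H)) :=
      Algebra.adjoin_mono (Set.image_mono h)
    induction x using induct with
    | one => exact ⟨⊥, inferInstance, one_mem _⟩
    | smul c x h =>
      obtain ⟨V, hV, hx⟩ := h
      exact ⟨V, hV, Subalgebra.smul_mem _ hx c⟩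
    | add x y hx hy =>
      obtain ⟨V, hV, hx⟩ := hx
      obtain ⟨W, hW, hy⟩ := hy
      exact ⟨V ⊔ W, inferInstance, add_mem (mono le_sup_left hx) (mono le_sup_right hy)⟩
    | mul v x hx =>
      obtain ⟨V, hV, hx⟩ := hx
      exact ⟨V ⊔ Submodule.span ℂ {v}, inferInstance, mul_mem
        (Algebra.subset_adjoin ⟨v, Submodule.mem_sup_right (Submodule.mem_span_singleton_self v),
          rfl⟩) (mono le_sup_left hx)⟩
  let b := stdOrthonormalBasis ℂ V
  refine ⟨_, fun i => (b i : H), b.orthonormal.comp_linearIsometry V.subtypeₗᵢ, ?_⟩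
  have hle : Algebra.adjoin ℂ (ι '' (V : Set H)) ≤ (poly fun i => (b i : H)).range := by
    refine Algebra.adjoin_le ?_
    rintro _ ⟨v, hv, rfl⟩
    refine ⟨∑ i, (inner ℂ (b i) (⟨v, hv⟩ : V) : ℂ) • MvPolynomial.X i, ?_⟩
    have h : ∑ i, (inner ℂ (b i) (⟨v, hv⟩ : V) : ℂ) • (b i : H) = v := by
      have := congrArg (Subtype.val) (b.sum_repr' ⟨v, hv⟩)
      simpa using this
    conv_rhs => rw [← h]
    simp [poly]
  exact hle hx

end Positivity

theorem inner_self (x : FockDomain H) :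
    0 ≤ (inner ℂ x x : ℂ) ∧ ((inner ℂ x x : ℂ) = 0 → x = 0) := by
  obtain ⟨n, e, he, p, rfl⟩ := exists_poly x
  rw [inner_poly he]
  have h0 : ∀ s ∈ p.support, 0 ≤ ((∏ i, (s i).factorial : ℕ) : ℂ) *
      (conj (MvPolynomial.coeff s p) * MvPolynomial.coeff s p) := by
    intro s _
    refine mul_nonneg (Nat.cast_nonneg _) ?_
    rw [← Complex.normSq_eq_conj_mul_self]
    exact_mod_cast Complex.normSq_nonneg _
  refine ⟨Finset.sum_nonneg h0, fun h => ?_⟩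
  rw [Finset.sum_eq_zero_iff_of_nonneg h0] at h
  have : p = 0 := by
    by_contra hp
    obtain ⟨s, hs⟩ := MvPolynomial.support_nonempty.mpr hp
    have h1 := h s hs
    rw [MvPolynomial.mem_support_iff] at hs
    have h2 : ((∏ i, (s i).factorial : ℕ) : ℂ) ≠ 0 :=
      Nat.cast_ne_zero.mpr (Finset.prod_ne_zero_iff.mpr fun i _ => Nat.factorial_ne_zero _)
    simp_all
  rw [this, map_zero]

/-- The symmetric product `v₁ ∘ ⋯ ∘ vₙ`. -/
def symProd {n : ℕ} (v : Fin n → H) : FockDomain H :=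
  ((Real.sqrt n.factorial)⁻¹ : ℂ) • ∏ i, ι (v i)

theorem ann_prod (f : H) {n : ℕ} (v : Fin (n + 1) → H) :
    ann f (∏ i, ι (v i)) = ∑ j, (inner ℂ f (v j) : ℂ) • ∏ i, ι (v (j.succAbove i)) := by
  induction n with
  | zero => simp [ann_ι, Algebra.algebraMap_eq_smul_one]
  | succ n ih =>
    rw [Fin.prod_univ_succ, ann_ι_mul, ih (fun i => v i.succ), Finset.mul_sum,
      Fin.sum_univ_succ (n := n + 1)]
    congr 1
    refine Finset.sum_congr rfl fun j _ => ?_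
    rw [Algebra.mul_smul_comm, Fin.prod_univ_succ (n := n)]
    simp only [Fin.succ_succAbove_zero, Fin.succ_succAbove_succ]

theorem prod_succAbove_eq {A : Type*} [CommMonoid A] {n : ℕ} (j : Fin (n + 1))
    (g : Fin (n + 1) → A) :
    ∏ i, g (j.succAbove i) = ∏ i : Fin n, g (Equiv.swap 0 j i.succ) := by
  have h1 : Function.Injective fun i : Fin n => j.succAbove i := Fin.succAbove_right_injective
  have h2 : Function.Injective fun i : Fin n => Equiv.swap 0 j i.succ :=
    (Equiv.injective _).comp (Fin.succ_injective n)
  have e1 : Finset.univ.image (fun i : Fin n => j.succAbove i) = {j}ᶜ := by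
    refine Finset.eq_of_subset_of_card_le ?_ ?_
    · intro x hx
      obtain ⟨i, -, rfl⟩ := Finset.mem_image.mp hx
      simp
    · simp [Finset.card_compl]
  have e2 : Finset.univ.image (fun i : Fin n => Equiv.swap 0 j i.succ) = {j}ᶜ := by
    refine Finset.eq_of_subset_of_card_le ?_ ?_
    · intro x hx
      obtain ⟨i, -, rfl⟩ := Finset.mem_image.mp hx
      simp [Equiv.swap_apply_eq_iff]
    · simp [Finset.card_image_of_injective _ h2, Finset.card_compl]
  rw [← Finset.prod_image (f := g) (h1.injOn), ← Finset.prod_image (f := g) (h2.injOn), e1, e2]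

theorem inner_prod {n : ℕ} (u v : Fin n → H) :
    (inner ℂ (∏ i, ι (u i)) (∏ i, ι (v i)) : ℂ)
      = ∑ π : Equiv.Perm (Fin n), ∏ i, inner ℂ (u i) (v (π i)) := by
  induction n with
  | zero => simp [inner_one_l]
  | succ n ih =>
    have hsum : ∀ (x : FockDomain H) (c : Fin (n + 1) → ℂ) (y : Fin (n + 1) → FockDomain H),
        inner ℂ x (∑ j, c j • y j) = ∑ j, c j * (inner ℂ x (y j) : ℂ) := by
      intro x c y
      simp [inner_def]
    rw [Fin.prod_univ_succ, inner_ι_mul_l, ann_prod, hsum,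
      ← Equiv.sum_comp (Equiv.Perm.decomposeFin (n := n)).symm, Fintype.sum_prod_type]
    refine Finset.sum_congr rfl fun j _ => ?_
    rw [prod_succAbove_eq j fun i => ι (v i), ih (fun i => u i.succ), Finset.mul_sum]
    refine Finset.sum_congr rfl fun π _ => ?_
    rw [Fin.prod_univ_succ]
    simp only [Equiv.Perm.decomposeFin_symm_apply_zero, Equiv.Perm.decomposeFin_symm_apply_succ]

theorem inner_prod_of_ne {n m : ℕ} (h : n ≠ m) (u : Fin n → H) (v : Fin m → H) :
    (inner ℂ (∏ i, ι (u i)) (∏ i, ι (v i)) : ℂ) = 0 := by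
  induction n generalizing m with
  | zero =>
    obtain ⟨m, rfl⟩ := Nat.exists_eq_succ_of_ne_zero h.symm
    simp [inner_one_l, vacCoeff, Fin.prod_univ_succ]
  | succ n ih =>
    rw [Fin.prod_univ_succ, inner_ι_mul_l]
    cases m with
    | zero =>
      rw [Fin.prod_univ_zero, ann_one, ← zero_smul ℂ (0 : FockDomain H), inner_smul_r, zero_mul]
    | succ m =>
      have hsum : ∀ (x : FockDomain H) (c : Fin (m + 1) → ℂ) (y : Fin (m + 1) → FockDomain H),
          inner ℂ x (∑ j, c j • y j) = ∑ j, c j * (inner ℂ x (y j) : ℂ) := by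
        intro x c y
        simp [inner_def]
      rw [ann_prod, hsum]
      exact Finset.sum_eq_zero fun j _ => by rw [ih (by omega), mul_zero]

/-- The scalar product of symmetric products:
`⟨u₁ ∘ ⋯ ∘ uₙ, v₁ ∘ ⋯ ∘ vₘ⟩ = δ_{n,m} (1/n!) ∑_π ∏ᵢ ⟨uᵢ, v_{π(i)}⟩`. -/
theorem inner_symProd {n : ℕ} (u v : Fin n → H) :
    (inner ℂ (symProd u) (symProd v) : ℂ)
      = (n.factorial : ℂ)⁻¹ * ∑ π : Equiv.Perm (Fin n), ∏ i, inner ℂ (u i) (v (π i)) := by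
  have h : (Real.sqrt n.factorial : ℂ) * Real.sqrt n.factorial = n.factorial := by
    rw [← Complex.ofReal_mul, Real.mul_self_sqrt (Nat.cast_nonneg _), Complex.ofReal_natCast]
  rw [symProd, symProd, inner_smul_l, inner_smul_r, inner_prod, ← mul_assoc, map_inv₀,
    Complex.conj_ofReal, ← mul_inv, h]

theorem inner_symProd_of_ne {n m : ℕ} (h : n ≠ m) (u : Fin n → H) (v : Fin m → H) :
    (inner ℂ (symProd u) (symProd v) : ℂ) = 0 := by
  rw [symProd, symProd, inner_smul_l, inner_smul_r, inner_prod_of_ne h, mul_zero, mul_zero]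

/-- The action of the creation operators: `a*(f) (v₁ ∘ ⋯ ∘ vₙ) = √(n+1) f ∘ v₁ ∘ ⋯ ∘ vₙ`. -/
theorem create_symProd (f : H) {n : ℕ} (v : Fin n → H) :
    create f (symProd v) = (Real.sqrt (n + 1) : ℂ) • symProd (Fin.cons f v : Fin (n + 1) → H) := by
  rw [create_apply, symProd, symProd, Algebra.mul_smul_comm, smul_smul, Fin.prod_univ_succ]
  simp only [Fin.cons_zero, Fin.cons_succ]
  congr 1
  rw [Nat.factorial_succ, Nat.cast_mul, Real.sqrt_mul (by positivity), Complex.ofReal_mul, mul_inv,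
    ← mul_assoc]
  have : (Real.sqrt (n + 1) : ℂ) ≠ 0 := by
    exact_mod_cast (Real.sqrt_pos.mpr (by positivity)).ne'
  push_cast
  rw [mul_inv_cancel₀ this, one_mul]

/-- The action of the annihilation operators:
`a(f) (v₁ ∘ ⋯ ∘ vₙ₊₁) = (n+1)^{-1/2} ∑ⱼ ⟨f, vⱼ⟩ v₁ ∘ ⋯ v̌ⱼ ⋯ ∘ vₙ₊₁`. -/
theorem ann_symProd (f : H) {n : ℕ} (v : Fin (n + 1) → H) :
    ann f (symProd v) = (Real.sqrt (n + 1) : ℂ)⁻¹ •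
      ∑ j, (inner ℂ f (v j) : ℂ) • symProd fun i => v (j.succAbove i) := by
  simp only [symProd, map_smul, ann_prod, Finset.smul_sum]
  refine Finset.sum_congr rfl fun j _ => ?_
  rw [smul_smul, smul_smul, smul_smul]
  congr 1
  rw [Nat.factorial_succ, Nat.cast_mul, Real.sqrt_mul (by positivity), Complex.ofReal_mul, mul_inv]
  push_cast
  ring

/-- The second quantization of `T`: the map `v₁ ∘ ⋯ ∘ vₙ ↦ T v₁ ∘ ⋯ ∘ T vₙ`. -/
def secondQuant (T : H →ₗ[ℂ] H) : Module.End ℂ (FockDomain H) := (lift (ι ∘ₗ T)).toLinearMap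

theorem secondQuant_symProd (T : H →ₗ[ℂ] H) {n : ℕ} (v : Fin n → H) :
    secondQuant T (symProd v) = symProd fun i => T (v i) := by
  simp [secondQuant, symProd]

/-- The scalar product is positive definite. -/
abbrev core : InnerProductSpace.Core ℂ (FockDomain H) where
  conj_inner_symm := inner_symm
  re_inner_nonneg x := (Complex.nonneg_iff.mp (inner_self x).1).1
  add_left := inner_add_l
  smul_left x y c := inner_smul_l c x y
  definite x := (inner_self x).2

instance : NormedAddCommGroup (FockDomain H) := core.toNormedAddCommGroup

instance : InnerProductSpace ℂ (FockDomain H) := InnerProductSpace.ofCore core.toCore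

end FockDomain

variable (H) in
/-- The symmetric Fock space `Γ(H)`: the Hilbert space completion of the finite particle domain. -/
abbrev Fock : Type _ := UniformSpace.Completion (FockDomain H)

variable (H) in
/-- The vacuum vector. -/
def vacuum : Fock H := ((1 : FockDomain H) : Fock H)

/-- The vacuum expectation `⟨Ω, T Ω⟩` of an operator defined on the finite particle domain. -/
def vacuumExpectation (T : Module.End ℂ (FockDomain H)) : ℂ :=
  inner ℂ (vacuum H) ((T 1 : FockDomain H) : Fock H)

end Fock

/-! ### The multiple symmetric Fock space and the filtered operators -/

/-- The one-particle space `𝒦 = L²(ℝ⁺)`. -/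
abbrev K : Type := Lp ℂ 2 (volume.restrict (Set.Ici (0 : ℝ)))

/-- The one-particle space `ℋ = L²(ℝ⁺, 𝒢) ≅ L²(ℝ⁺) ⊗ 𝒢`. -/
abbrev OneParticle (G : Type*) [NormedAddCommGroup G] [InnerProductSpace ℂ G] : Type _ :=
  Lp G 2 (volume.restrict (Set.Ici (0 : ℝ)))

/-- The indicator function `χ_{[s,t]}` in `L²(ℝ⁺)`. -/
def chi (s t : ℝ) : K :=
  indicatorConstLp 2 (measurableSet_Icc (a := s) (b := t))
    ((Measure.restrict_apply_le _ _).trans_lt measure_Icc_lt_top).ne (1 : ℂ)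

section Filtered
variable {G : Type*} [NormedAddCommGroup G] [InnerProductSpace ℂ G]

/-- The vector `f ⊗ g` of `L²(ℝ⁺, 𝒢)`, i.e. the function `x ↦ f(x) g`. -/
def tens (f : K) (g : G) : OneParticle G := (ContinuousLinearMap.toSpanSingleton ℂ g).compLp f

variable [CompleteSpace G]

/-- The closed subspace `ℋ^{(σ)}` of the vectors `∑_{k ∈ σ} u^{(k)} ⊗ e_k`. -/
def colorSubspace (e : HilbertBasis ℕ ℂ G) (σ : Set ℕ) : Submodule ℂ (OneParticle G) :=
  (Submodule.span ℂ {u | ∃ f : K, ∃ k ∈ σ, u = tens f (e k)}).topologicalClosure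

instance (e : HilbertBasis ℕ ℂ G) (σ : Set ℕ) : (colorSubspace e σ).HasOrthogonalProjection :=
  haveI : CompleteSpace (colorSubspace e σ) := Submodule.topologicalClosure.completeSpace _
  inferInstance

/-- The projection `P^{(σ)}`: the second quantization of the orthogonal projection onto
`ℋ^{(σ)}`. -/
def filterProj (e : HilbertBasis ℕ ℂ G) (σ : Set ℕ) : Module.End ℂ (FockDomain (OneParticle G)) :=
  FockDomain.secondQuant (colorSubspace e σ).starProjection.toLinearMap

/-- The filtered annihilation operator `a^{(σ)}(v) = P^{(σ)} a(v)`. -/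
def filteredAnn (e : HilbertBasis ℕ ℂ G) (σ : Set ℕ) (v : OneParticle G) :
    Module.End ℂ (FockDomain (OneParticle G)) :=
  filterProj e σ * FockDomain.ann v

/-- The filtered creation operator `a^{(σ)*}(v) = a*(v) P^{(σ)}`. -/
def filteredCreate (e : HilbertBasis ℕ ℂ G) (σ : Set ℕ) (v : OneParticle G) :
    Module.End ℂ (FockDomain (OneParticle G)) :=
  FockDomain.create v * filterProj e σ

end Filtered

end Filtered

end

/-!
Both sides are sums over pair partitions of the positions `1, …, n`, and they are compared through
the recursion that removes the first position together with its partner.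

Expanding the random walks turns the left-hand side into a sum over all assignments `l` of sites to
positions. The product state factorizes over the sites, so each assignment contributes the product
over the fibers `B` of `l` of `siteMoment φ k σ starred B`, the value of `φ̂` on the word with the
letters in `B` active and all others replaced by their filters `P(σ_i)`
(`PhiHat_prod_randomWalk`). The Boolean extension of `φ` splits at every `P`. As `φ` is centered,
the site moment of a singleton vanishes (`siteMoment_eq_zero`), and that of a pair `i < j` is `1`
exactly if the letters are an `X` and an `X*` of the same color, in this order, such that no filter
strictly between them blocks the color (`siteMoment_pair`, `Contracts`).

Sorting the assignments by the fiber of the first position (`assignmentSum_eq`) gives a recursion on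
the set `S` of positions still to be assigned. Each step excludes one more site for the remaining
positions, so the limit `N → ∞` is taken uniformly in the choice of boundedly many excluded sites
(`uniformAtTop`). A fiber with `b` elements carries the factor `N^{-b/2}` and a sum over `O(N)`
sites: fibers with more than two elements disappear, and a pair contributes the limiting proportion
of the sites common to the two walks, the length of the overlap of the two time intervals
(`tendsto_assignmentSum`).

On the Fock space the leftmost operator of the word has to be an annihilation operator. Moved to the
right, it passes each filtered operator up to the factor `1` or `0` according to whether the filter
contains its color, and it contracts with each creation operator of its color, leaving that
operator's filter in its place. This is the same recursion (`fockMoment_eq_sum`), for the scalar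
product of `χ_{[s,t]} ⊗ e_k` and `χ_{[s',t']} ⊗ e_{k'}` is the length of the overlap if `k = k'` and
`0` otherwise.
-/

namespace Filtered

/-! ### Words of operators and their tails -/

section Words
variable {M : Type*} {n : ℕ}

theorem drop_ofFn_eq_cons (U : Fin n → M) {p : ℕ} (hp : p < n) :
    (List.ofFn U).drop p = U ⟨p, hp⟩ :: (List.ofFn U).drop (p + 1) := by
  rw [List.drop_eq_getElem_cons (by simpa using hp)]
  simp

theorem drop_ofFn_congr {U V : Fin n → M} {p : ℕ} (h : ∀ i : Fin n, p ≤ i → U i = V i) :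
    (List.ofFn U).drop p = (List.ofFn V).drop p := by
  apply List.ext_getElem (by simp)
  intro i h1 h2
  simp only [List.getElem_drop, List.getElem_ofFn]
  exact h _ (by simp)

variable {R D : Type*} [CommRing R] [AddCommGroup D] [Module R D]

/-- Pulling an operator `a` that kills `x` through a word: if `a` commutes with each letter up to
the factor `θ j` and the correction `γ j • U' j`, then only the corrections remain, the one at `m`
carrying the factors of the letters to the left of `m`. -/
theorem apply_drop_prod (a : Module.End R D) (U U' : Fin n → Module.End R D) (θ γ : Fin n → R)
    {x : D} (hx : a x = 0) (p : ℕ)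
    (h : ∀ j : Fin n, p ≤ j → ∀ y, a (U j y) = θ j • U j (a y) + γ j • U' j y) :
    a (((List.ofFn U).drop p).prod x) = ∑ m ∈ Finset.univ.filter fun m : Fin n => p ≤ (m : ℕ),
      ((∏ j ∈ Finset.univ.filter fun j : Fin n => p ≤ (j : ℕ) ∧ j < m, θ j) * γ m) •
        ((List.ofFn (Function.update U m (U' m))).drop p).prod x := by
  induction hd : n - p generalizing p with
  | zero =>
    have hnp : n ≤ p := by omega
    rw [Finset.filter_false_of_mem (fun m _ => by omega), List.drop_eq_nil_of_le (by simpa)]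
    simp [hx]
  | succ d ih =>
    have hp : p < n := by omega
    have hrest := ih (p + 1) (fun j hj => h j (by omega)) (by omega)
    have hset : (Finset.univ.filter fun m : Fin n => p ≤ (m : ℕ))
        = insert ⟨p, hp⟩ (Finset.univ.filter fun m : Fin n => p + 1 ≤ (m : ℕ)) := by
      ext m
      simp [Fin.ext_iff]
      omega
    rw [drop_ofFn_eq_cons U hp, List.prod_cons, Module.End.mul_apply, h _ le_rfl, hrest, hset,
      Finset.sum_insert (by simp), map_sum, Finset.smul_sum, add_comm]
    congr 1
    · rw [Finset.filter_false_of_mem (fun j _ => by rw [Fin.lt_def]; simp), Finset.prod_empty,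
        one_mul, drop_ofFn_eq_cons _ hp, List.prod_cons, Module.End.mul_apply,
        Function.update_self]
      congr 4
      exact drop_ofFn_congr fun i hi => by
        rw [Function.update_of_ne]; rintro rfl; simp at hi
    · refine Finset.sum_congr rfl fun m hm => ?_
      have hm' : p + 1 ≤ (m : ℕ) := by simpa using hm
      have hset' : (Finset.univ.filter fun j : Fin n => p ≤ (j : ℕ) ∧ j < m)
          = insert ⟨p, hp⟩ (Finset.univ.filter fun j : Fin n => p + 1 ≤ (j : ℕ) ∧ j < m) := by
        ext j
        simp only [Finset.mem_filter, Finset.mem_univ, true_and, Finset.mem_insert, Fin.ext_iff,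
          Fin.lt_def]
        have := j.2
        omega
      rw [hset', Finset.prod_insert (by simp), drop_ofFn_eq_cons _ hp, List.prod_cons,
        Module.End.mul_apply, Function.update_of_ne (by simp [Fin.ext_iff]; omega), map_smul,
        smul_smul, mul_assoc]

/-- The letters of a word that fix a linear functional from the right can be dropped from the left
end of the word. -/
theorem functional_prod_eq_drop (ℓ : D →ₗ[R] R) (U : Fin n → Module.End R D) (p : ℕ)
    (h : ∀ i : Fin n, (i : ℕ) < p → ∀ y, ℓ (U i y) = ℓ y) (x : D) :
    ℓ ((List.ofFn U).prod x) = ℓ (((List.ofFn U).drop p).prod x) := by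
  induction p with
  | zero => simp
  | succ p ih =>
    rw [ih fun i hi => h i (by omega)]
    by_cases hp : p < n
    · rw [drop_ofFn_eq_cons U hp, List.prod_cons, Module.End.mul_apply, h _ (by simp)]
    · rw [List.drop_eq_nil_of_le (by simp; omega), List.drop_eq_nil_of_le (by simp; omega)]

end Words

/-! ### Vacuum expectations of words of filtered operators -/

open FockDomain in
theorem vacuumExpectation_eq {H : Type*} [NormedAddCommGroup H] [InnerProductSpace ℂ H]
    (T : Module.End ℂ (FockDomain H)) : vacuumExpectation T = vacCoeff (T 1) := by
  rw [vacuumExpectation, vacuum, UniformSpace.Completion.inner_coe]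
  exact inner_one_l _

theorem inner_chi (s t s' t' : ℝ) (hs : 0 ≤ s) :
    inner ℂ (chi s t) (chi s' t') = ((max 0 (min t t' - max s s') : ℝ) : ℂ) := by
  have hfin (a b : ℝ) : volume.restrict (Set.Ici (0 : ℝ)) (Set.Icc a b) ≠ ⊤ :=
    ((Measure.restrict_apply_le _ _).trans_lt measure_Icc_lt_top).ne
  rw [chi, chi, L2.inner_indicatorConstLp_indicatorConstLp _ _ (hfin _ _) (hfin _ _)]
  have : Set.Icc s t ∩ Set.Icc s' t' ∩ Set.Ici 0 = Set.Icc (max s s') (min t t') := by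
    rw [Set.Icc_inter_Icc, Set.inter_eq_left]
    exact fun x hx => hs.trans ((le_max_left _ _).trans hx.1)
  rw [measureReal_restrict_apply (measurableSet_Icc.inter measurableSet_Icc), this,
    Real.volume_real_Icc, max_comm]
  simp

section Fock
variable {G : Type*} [NormedAddCommGroup G] [InnerProductSpace ℂ G]

theorem inner_tens (f f' : K) (g g' : G) :
    inner ℂ (tens f g) (tens f' g') = (inner ℂ f f' : ℂ) * inner ℂ g g' := by
  rw [L2.inner_def, L2.inner_def, ← integral_mul_const]
  apply integral_congr_ae
  filter_upwards [ContinuousLinearMap.coeFn_compLp (ContinuousLinearMap.toSpanSingleton ℂ g) f,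
    ContinuousLinearMap.coeFn_compLp (ContinuousLinearMap.toSpanSingleton ℂ g') f'] with x h1 h2
  simp only [tens]
  rw [h1, h2]
  simp [inner_smul_left, inner_smul_right]
  ring

variable (e : HilbertBasis ℕ ℂ G)

theorem inner_tens_basis (f f' : K) (k k' : ℕ) :
    inner ℂ (tens f (e k)) (tens f' (e k')) = if k = k' then (inner ℂ f f' : ℂ) else 0 := by
  rw [inner_tens, orthonormal_iff_ite.mp e.orthonormal]
  split_ifs <;> simp

variable [CompleteSpace G]

theorem starProjection_colorSubspace_tens (σ : Set ℕ) (f : K) (k : ℕ) [Decidable (k ∈ σ)] :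
    (colorSubspace e σ).starProjection (tens f (e k)) = if k ∈ σ then tens f (e k) else 0 := by
  split_ifs with h
  · exact Submodule.starProjection_eq_self_iff.mpr
      (Submodule.le_topologicalClosure _ (Submodule.subset_span ⟨f, k, h, rfl⟩))
  · rw [Submodule.starProjection_apply_eq_zero_iff, colorSubspace, Submodule.orthogonal_closure,
      Submodule.mem_orthogonal]
    intro u hu
    induction hu using Submodule.span_induction with
    | mem u hu =>
      obtain ⟨f', k', hk', rfl⟩ := hu
      rw [inner_tens_basis, if_neg]
      rintro rfl
      exact h hk'
    | zero => simp
    | add u v _ _ hu hv => rw [inner_add_left, hu, hv, add_zero]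
    | smul c u _ hu => rw [inner_smul_left, hu, mul_zero]

open FockDomain

theorem ann_zero_left {H : Type*} [NormedAddCommGroup H] [InnerProductSpace ℂ H]
    (x : FockDomain H) : ann (0 : H) x = 0 := by
  simpa using ann_smul (0 : ℂ) (0 : H) x

theorem ann_secondQuant {H : Type*} [NormedAddCommGroup H] [InnerProductSpace ℂ H]
    {T : H →ₗ[ℂ] H} (hT : T.IsSymmetric) (v : H) (x : FockDomain H) :
    ann v (secondQuant T x) = secondQuant T (ann (T v) x) := by
  have hmul (x y : FockDomain H) : secondQuant T (x * y) = secondQuant T x * secondQuant T y := by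
    simp [secondQuant]
  have hι (w : H) : secondQuant T (ι w) = ι (T w) := by simp [secondQuant]
  have h1 : secondQuant T (1 : FockDomain H) = 1 := by simp [secondQuant]
  induction x using induct with
  | one => simp [h1, ann_one]
  | smul c x h => simp [h]
  | add x y hx hy => simp [hx, hy]
  | mul w x h =>
    rw [hmul, hι, ann_ι_mul, ann_ι_mul, h, map_add, map_smul, hmul, hι, ← hT v w]

theorem vacCoeff_filterProj (σ : Set ℕ) (x : FockDomain (OneParticle G)) :
    vacCoeff (filterProj e σ x) = vacCoeff x := by
  have : (vacCoeff (H := OneParticle G)).comp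
      (FockDomain.lift (ι ∘ₗ (colorSubspace e σ).starProjection.toLinearMap)) = vacCoeff := by
    apply hom_ext
    intro v
    simp [vacCoeff]
  exact congr($this x)

open Classical in
theorem ann_filterProj (σ : Set ℕ) (f : K) (k : ℕ) (x : FockDomain (OneParticle G)) :
    ann (tens f (e k)) (filterProj e σ x)
      = (if k ∈ σ then 1 else 0 : ℂ) • filterProj e σ (ann (tens f (e k)) x) := by
  rw [filterProj, ann_secondQuant (Submodule.starProjection_isSymmetric _)]
  rw [ContinuousLinearMap.coe_coe, starProjection_colorSubspace_tens]
  split_ifs with h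
  · simp
  · simp [ann_zero_left]

variable {n : ℕ} (k : Fin n → ℕ) (σ : Fin n → Set ℕ) (s t : Fin n → ℝ) (starred : Fin n → Bool)

/-- The filtered operator at position `i` of a word. -/
noncomputable def filteredOp (i : Fin n) : Module.End ℂ (FockDomain (OneParticle G)) :=
  if starred i then filteredCreate e (σ i) (tens (chi (s i) (t i)) (e (k i)))
  else filteredAnn e (σ i) (tens (chi (s i) (t i)) (e (k i)))

/-- The word of filtered operators in which the operators at the positions outside `S` are replaced
by the projections `P^{(σ_i)}`. -/
noncomputable def fockWord (S : Finset (Fin n)) :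
    Fin n → Module.End ℂ (FockDomain (OneParticle G)) :=
  S.piecewise (filteredOp e k σ s t starred) fun i => filterProj e (σ i)

/-- The vacuum expectation of the word with filtered operators at the positions in `S` and
projections elsewhere. -/
noncomputable def fockMoment (S : Finset (Fin n)) : ℂ :=
  vacCoeff ((List.ofFn (fockWord e k σ s t starred S)).prod 1)

/-- The condition on two positions `i < j` to contract: an annihilation operator on the left of a
creation operator of the same color, which all filters in between let pass. -/
def Contracts (i j : Fin n) : Prop :=
  starred i = false ∧ starred j = true ∧ k i = k j ∧ ∀ l, i < l → l < j → k i ∈ σ l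

/-- The length of the intersection of the time intervals at the positions `i` and `j`. -/
noncomputable def overlap (i j : Fin n) : ℝ := max 0 (min (t i) (t j) - max (s i) (s j))

theorem fockMoment_empty : fockMoment e k σ s t starred ∅ = 1 := by
  have := functional_prod_eq_drop (vacCoeff (H := OneParticle G)).toLinearMap
    (fockWord e k σ s t starred ∅) n
    (fun i _ y => by simpa [fockWord] using vacCoeff_filterProj e (σ i) y) 1
  rw [List.drop_eq_nil_of_le (by simp)] at this
  simpa [fockMoment] using this

open Classical in
/-- Wick's formula: the first operator of the word is contracted with each of the others, the
filters between the two being the only constraint. -/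
theorem fockMoment_eq_sum (hs : ∀ i, 0 ≤ s i) {S : Finset (Fin n)} {i : Fin n} (hi : i ∈ S)
    (hmin : ∀ j ∈ S, i ≤ j) :
    fockMoment e k σ s t starred S = ∑ j ∈ S.erase i,
      (if Contracts k σ starred i j then (overlap s t i j : ℂ) else 0) *
        fockMoment e k σ s t starred ((S.erase i).erase j) := by
  set W := fockWord e k σ s t starred with hW
  have hproj : ∀ (S' : Finset (Fin n)) (j : Fin n), j ∉ S' → W S' j = filterProj e (σ j) :=
    fun S' j hj => Finset.piecewise_eq_of_notMem _ _ _ hj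
  have hvac : ∀ (S' : Finset (Fin n)) (p : ℕ), (∀ j ∈ S', p ≤ (j : ℕ)) →
      fockMoment e k σ s t starred S' = vacCoeff (((List.ofFn (W S')).drop p).prod 1) := by
    intro S' p hp
    refine functional_prod_eq_drop (vacCoeff (H := OneParticle G)).toLinearMap (W S') p
      (fun j hj y => ?_) 1
    rw [hproj S' j fun h => absurd (hp j h) (by omega)]
    exact vacCoeff_filterProj e (σ j) y
  rw [hvac S i fun j hj => hmin j hj, drop_ofFn_eq_cons _ i.2, List.prod_cons,
    Module.End.mul_apply]
  have hWi : W S ⟨i, i.2⟩ = filteredOp e k σ s t starred i :=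
    Finset.piecewise_eq_of_mem _ _ _ hi
  rw [hWi]
  by_cases hst : starred i = true
  · rw [filteredOp, if_pos hst, filteredCreate, Module.End.mul_apply, create_apply, map_mul]
    rw [Finset.sum_eq_zero]
    · simp [vacCoeff]
    · intro j _
      rw [if_neg (fun h => by simp [h.1] at hst), zero_mul]
  · have hst' : starred i = false := by simpa using hst
    rw [filteredOp, if_neg hst, filteredAnn, Module.End.mul_apply, vacCoeff_filterProj]
    rw [apply_drop_prod (ann (tens (chi (s i) (t i)) (e (k i)))) (W S)
      (fun j => filterProj e (σ j)) (fun j => if k i ∈ σ j then 1 else 0)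
      (fun j => if j ∈ S then (if starred j = true ∧ k i = k j then (overlap s t i j : ℂ) else 0)
        else 0) (ann_one _) (i + 1)]
    · rw [map_sum (vacCoeff (H := OneParticle G))]
      have hsub : S.erase i ⊆ Finset.univ.filter fun m : Fin n => (i : ℕ) + 1 ≤ m := by
        intro j hj
        have := hmin j (Finset.mem_of_mem_erase hj)
        have hne := Finset.ne_of_mem_erase hj
        simp only [Finset.mem_filter, Finset.mem_univ, true_and]
        rw [Fin.le_def] at this
        rw [Ne, Fin.ext_iff] at hne
        omega
      rw [← Finset.sum_subset hsub]
      · refine Finset.sum_congr rfl fun j hj => ?_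
        have hjS := Finset.mem_of_mem_erase hj
        rw [map_smul, smul_eq_mul]
        congr 1
        · rw [Finset.prod_ite_zero, Finset.prod_const_one, if_pos hjS]
          have : Contracts k σ starred i j ↔
              (∀ l ∈ Finset.univ.filter fun l : Fin n => (i : ℕ) + 1 ≤ l ∧ l < j, k i ∈ σ l) ∧
                (starred j = true ∧ k i = k j) := by
            simp only [Contracts, hst', true_and, Finset.mem_filter, Finset.mem_univ, Fin.lt_def,
              Nat.succ_le_iff]
            tauto
          rw [if_congr this rfl rfl]
          split_ifs <;> first | (exfalso; tauto) | simp
        · rw [hvac _ (i + 1)]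
          · congr 3
            refine drop_ofFn_congr fun l hl => ?_
            have hli : l ≠ i := by rintro rfl; omega
            by_cases hlj : l = j
            · subst hlj
              rw [Function.update_self, hproj _ _ (by simp)]
            · rw [Function.update_of_ne hlj, hW, fockWord, fockWord]
              by_cases hlS : l ∈ S
              · rw [Finset.piecewise_eq_of_mem _ _ _ hlS,
                  Finset.piecewise_eq_of_mem _ _ _ (by simp [hlS, hlj, hli])]
              · rw [Finset.piecewise_eq_of_notMem _ _ _ hlS,
                  Finset.piecewise_eq_of_notMem _ _ _ (by simp [hlS])]
          · intro l hl
            have := hsub (Finset.mem_of_mem_erase hl)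
            simpa using this
      · intro j hj hjS
        have : j ∉ S := by
          intro h
          refine hjS (Finset.mem_erase.mpr ⟨?_, h⟩)
          rintro rfl
          simp at hj
        rw [if_neg this, mul_zero, zero_smul, map_zero]
    · intro j _ y
      by_cases hj : j ∈ S
      · have hWj : W S j = filteredOp e k σ s t starred j := Finset.piecewise_eq_of_mem _ _ _ hj
        rw [hWj, filteredOp, if_pos hj]
        by_cases hsj : starred j = true
        · rw [if_pos hsj, filteredCreate, Module.End.mul_apply, Module.End.mul_apply, create_apply,
            create_apply, ann_ι_mul, ann_filterProj, inner_tens_basis, inner_chi _ _ _ _ (hs i),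
            add_comm, Algebra.mul_smul_comm]
          simp only [hsj, true_and, overlap]
        · rw [if_neg hsj, filteredAnn, Module.End.mul_apply, Module.End.mul_apply, ann_filterProj,
            ann_comm]
          simp [hsj]
      · rw [hproj S j hj, if_neg hj, zero_smul, add_zero, ann_filterProj]

end Fock

/-! ### Product functionals -/

section ProdFunctional
variable {A : Type} [Ring A] [Algebra ℂ A] (ψ : A →ₗ[ℂ] ℂ) (a : ℕ → A)

open Classical in
theorem prodFunctional_tprod :
    prodFunctional ψ (PiTensorProduct.tprod ℂ a)
      = if {i | ψ (a i) ≠ 1}.Finite then ∏ᶠ i, ψ (a i) else 0 := by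
  rw [prodFunctional, PiTensorProduct.lift.tprod]
  rfl

theorem prodFunctional_tprod_eq_prod (A : Finset ℕ) (h : ∀ i ∉ A, ψ (a i) = 1) :
    prodFunctional ψ (PiTensorProduct.tprod ℂ a) = ∏ i ∈ A, ψ (a i) := by
  have hsub : {i | ψ (a i) ≠ 1} ⊆ A := fun i hi => by
    by_contra hA
    exact hi (h i hA)
  rw [prodFunctional_tprod, if_pos (A.finite_toSet.subset hsub)]
  exact finprod_eq_prod_of_mulSupport_subset _ hsub

theorem prodFunctional_tprod_eq_zero {i : ℕ} (h : ψ (a i) = 0) :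
    prodFunctional ψ (PiTensorProduct.tprod ℂ a) = 0 := by
  rw [prodFunctional_tprod]
  split_ifs with hf
  · rw [finprod_eq_prod_of_mulSupport_subset (s := hf.toFinset) _ (by simp [Function.mulSupport])]
    exact Finset.prod_eq_zero (i := i) (by simp [h]) h
  · rfl

/-- A word of elementary tensors is the elementary tensor of the words in each factor. -/
theorem prod_ofFn_tprod {n : ℕ} (b : Fin n → ℕ → A) :
    (List.ofFn fun i => (PiTensorProduct.tprod ℂ (b i) : InfTensor A)).prod
      = PiTensorProduct.tprod ℂ fun j => (List.ofFn fun i => b i j).prod := by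
  have h := map_list_prod (PiTensorProduct.tprodMonoidHom ℂ (A := fun _ : ℕ => A)) (List.ofFn b)
  rw [List.map_ofFn] at h
  refine h.symm.trans ?_
  change PiTensorProduct.tprod ℂ _ = _
  congr 1
  funext j
  rw [Pi.list_prod_apply, List.map_ofFn]
  rfl

end ProdFunctional

/-! ### The state at a single site -/

/-- A centered state is also centered on `Y*`. This uses only the hypothesis `φ(Y* Y) = 0`, which
makes `φ((1 + cY)* (1 + cY))` affine in `conj c`. -/
theorem State.apply_star_Y_eq_zero (φ : State YPoly) (hY : φ Y = 0) (hYstarY : φ (star Y * Y) = 0) :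
    φ (star Y) = 0 := by
  by_contra h0
  -- positivity at `1 + cY` with `conj c * φ (Y*) = -2`
  set c : ℂ := conj (-2 / φ (star Y)) with hc
  have hstar : star (c • Y) = conj c • star Y := by
    rw [Algebra.smul_def, star_mul, Algebra.smul_def]
    have : star (algebraMap ℂ YPoly c) = algebraMap ℂ YPoly (conj c) :=
      congrArg MulOpposite.unop (freeStarHom_algebraMap c)
    rw [this, Algebra.commutes]
  have h := φ.nonneg (1 + c • Y)
  have hcalc : φ (star (1 + c • Y) * (1 + c • Y)) = -1 := by
    rw [star_add, star_one, hstar]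
    simp only [add_mul, mul_add, one_mul, mul_one, map_add, map_smul, smul_mul_assoc,
      mul_smul_comm, φ.map_one, hY, hYstarY, smul_eq_mul]
    rw [hc, Complex.conj_conj]
    field_simp
    norm_num
  rw [hcalc, Complex.nonneg_iff] at h
  norm_num at h

section Site
variable (φ : State YPoly) {n : ℕ} (k : Fin n → ℕ) (σ : Fin n → Set ℕ) (starred : Fin n → Bool)

/-- The generator `X_{k_i}(σ_i)` or its adjoint at position `i` of a word. -/
noncomputable def walkLetter (i : Fin n) : FBialg :=
  if starred i then star (FBialg.X (k i) (σ i)) else FBialg.X (k i) (σ i)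

/-- The word seen by a site at which exactly the letters at the positions in `B` act, all other
letters contributing their filters. -/
noncomputable def siteWord (B : Finset (Fin n)) : Fin n → FBialg :=
  B.piecewise (walkLetter k σ starred) fun i => FBialg.P (σ i)

/-- The value of `φ̂` on `siteWord`. -/
noncomputable def siteMoment (B : Finset (Fin n)) : ℂ :=
  phiHat φ (List.ofFn (siteWord k σ starred B)).prod

/-- The letter `Y` or `Y*` at position `i` of a word. -/
noncomputable def yLetter (i : Fin n) : YPoly := if starred i then star Y else Y

open Classical in
/-- The component of `siteWord` in the color `c`. -/
noncomputable def colorWord (B : Finset (Fin n)) (c : ℕ) (i : Fin n) : YPPoly :=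
  if i ∈ B then (if c = k i then YPPoly.incl (yLetter starred i) else 1)
  else if c ∈ σ i then 1 else YPPoly.P

theorem eta_siteWord (B : Finset (Fin n)) (i : Fin n) :
    eta (siteWord k σ starred B i)
      = PiTensorProduct.tprod ℂ fun c => colorWord k σ starred B c i := by
  by_cases hi : i ∈ B
  · have : eta (siteWord k σ starred B i)
        = colorTensor (k i) (YPPoly.incl (yLetter starred i)) := by
      rw [siteWord, Finset.piecewise_eq_of_mem _ _ _ hi, walkLetter, yLetter, eta]
      split_ifs <;> simp
    rw [this, colorTensor]
    congr 1
    funext c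
    by_cases hc : c = k i
    · subst hc; simp [colorWord, hi]
    · simp [colorWord, hi, hc]
  · rw [siteWord, Finset.piecewise_eq_of_notMem _ _ _ hi, eta, FBialg.lift_P, filterTensor]
    congr 1
    funext c
    simp [colorWord, hi]

theorem siteMoment_eq (B : Finset (Fin n)) :
    siteMoment φ k σ starred B = prodFunctional (booleanExt φ)
      (PiTensorProduct.tprod ℂ fun c => (List.ofFn (colorWord k σ starred B c)).prod) := by
  rw [siteMoment, phiHat, LinearMap.comp_apply, AlgHom.toLinearMap_apply, map_list_prod,
    List.map_ofFn]
  congr 1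
  rw [← prod_ofFn_tprod]
  congr 2
  funext i
  exact eta_siteWord k σ starred B i

/-- The letters of `colorWord` as operators in the Boolean representation. -/
noncomputable def colorOp (B : Finset (Fin n)) (c : ℕ) (i : Fin n) : Module.End ℂ YPoly :=
  booleanRep φ (colorWord k σ starred B c i)

theorem booleanExt_colorWord (B : Finset (Fin n)) (c : ℕ) :
    booleanExt φ (List.ofFn (colorWord k σ starred B c)).prod
      = φ ((List.ofFn (colorOp φ k σ starred B c)).prod 1) := by
  change φ (booleanRep φ _ 1) = _
  rw [map_list_prod, List.map_ofFn]
  rfl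

variable {k σ starred} {B : Finset (Fin n)} {c : ℕ} {i : Fin n}

theorem colorOp_of_mem (hi : i ∈ B) (hc : c = k i) (x : YPoly) :
    colorOp φ k σ starred B c i x = yLetter starred i * x := by
  rw [colorOp, colorWord, if_pos hi, if_pos hc, booleanRep_incl]

theorem colorOp_of_ne (hi : i ∈ B) (hc : c ≠ k i) (x : YPoly) :
    colorOp φ k σ starred B c i x = x := by
  rw [colorOp, colorWord, if_pos hi, if_neg hc, map_one, Module.End.one_apply]

theorem colorOp_of_notMem (hi : i ∉ B) (x : YPoly) [Decidable (c ∈ σ i)] :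
    colorOp φ k σ starred B c i x = if c ∈ σ i then x else φ x • 1 := by
  rw [colorOp, colorWord, if_neg hi]
  split_ifs
  · rw [map_one, Module.End.one_apply]
  · exact booleanRep_P φ x

open Classical in
theorem apply_colorOp (h : i ∈ B → c ≠ k i) (x : YPoly) :
    φ (colorOp φ k σ starred B c i x) = φ x := by
  by_cases hi : i ∈ B
  · rw [colorOp_of_ne φ hi (h hi)]
  · rw [colorOp_of_notMem φ hi]
    split_ifs
    · rfl
    · rw [map_smul, φ.map_one, smul_eq_mul, mul_one]

open Classical in
theorem colorOp_one (h : i ∈ B → c ≠ k i) : colorOp φ k σ starred B c i 1 = 1 := by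
  by_cases hi : i ∈ B
  · rw [colorOp_of_ne φ hi (h hi)]
  · rw [colorOp_of_notMem φ hi]
    split_ifs
    · rfl
    · rw [φ.map_one, one_smul]

theorem colorOp_tail_one (p : ℕ) (h : ∀ j : Fin n, p ≤ j → j ∈ B → c ≠ k j) :
    ((List.ofFn (colorOp φ k σ starred B c)).drop p).prod 1 = 1 := by
  induction hd : n - p generalizing p with
  | zero => rw [List.drop_eq_nil_of_le (by simp; omega)]; rfl
  | succ d ih =>
    have hp : p < n := by omega
    rw [drop_ofFn_eq_cons _ hp, List.prod_cons, Module.End.mul_apply,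
      ih (p + 1) (fun j hj => h j (by omega)) (by omega), colorOp_one φ (h ⟨p, hp⟩ le_rfl)]

open Classical in
/-- Letters outside the color `c` let a vector pass if all filters do, and project it to the cyclic
vector otherwise. -/
theorem colorOp_tail_apply (p : ℕ) {m : Fin n} (hpm : p ≤ m)
    (h : ∀ j : Fin n, p ≤ j → j < m → j ∉ B) {x : YPoly}
    (hx : ((List.ofFn (colorOp φ k σ starred B c)).drop m).prod 1 = x) :
    ((List.ofFn (colorOp φ k σ starred B c)).drop p).prod 1
      = if ∀ l : Fin n, p ≤ l → l < m → c ∈ σ l then x else φ x • 1 := by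
  induction hd : (m : ℕ) - p generalizing p with
  | zero =>
    obtain rfl : p = m := by omega
    rw [hx, if_pos]
    intro l h1 h2
    rw [Fin.lt_def] at h2
    omega
  | succ d ih =>
    have hp : p < n := by omega
    have hpm' : (⟨p, hp⟩ : Fin n) < m := by rw [Fin.lt_def]; simp; omega
    rw [drop_ofFn_eq_cons _ hp, List.prod_cons, Module.End.mul_apply,
      ih (p + 1) (by omega) (fun j hj => h j (by omega)) (by omega),
      colorOp_of_notMem φ (h ⟨p, hp⟩ le_rfl hpm')]
    have hiff : (∀ l : Fin n, p ≤ l → l < m → c ∈ σ l) ↔ c ∈ σ ⟨p, hp⟩ ∧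
        ∀ l : Fin n, p + 1 ≤ l → l < m → c ∈ σ l := by
      refine ⟨fun H => ⟨H _ le_rfl hpm', fun l h1 => H l (by omega)⟩, fun H l h1 h2 => ?_⟩
      rcases h1.eq_or_lt with h1 | h1
      · have : l = ⟨p, hp⟩ := Fin.ext h1.symm
        rw [this]; exact H.1
      · exact H.2 l h1 h2
    rw [if_congr hiff rfl rfl]
    split_ifs <;> first | (exfalso; tauto) | simp [φ.map_one]

/-- A color carried by no active letter contributes the factor `1`. -/
theorem booleanExt_colorWord_eq_one (h : ∀ j ∈ B, c ≠ k j) :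
    booleanExt φ (List.ofFn (colorWord k σ starred B c)).prod = 1 := by
  have := colorOp_tail_one φ (σ := σ) (starred := starred) 0 fun j _ hj => h j hj
  rw [List.drop_zero] at this
  rw [booleanExt_colorWord, this, φ.map_one]

theorem booleanExt_colorWord_eq (hi : i ∈ B) (hc : c = k i)
    (h : ∀ j ∈ B, j < i → c ≠ k j) :
    booleanExt φ (List.ofFn (colorWord k σ starred B c)).prod
      = φ (yLetter starred i *
          ((List.ofFn (colorOp φ k σ starred B c)).drop (i + 1)).prod 1) := by
  rw [booleanExt_colorWord]
  refine (functional_prod_eq_drop φ.toLinearMap _ i (fun j hj y => ?_) 1).trans ?_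
  · exact apply_colorOp φ (fun hjB => h j hjB hj) y
  · rw [drop_ofFn_eq_cons _ i.2, List.prod_cons, Module.End.mul_apply]
    exact congrArg φ (colorOp_of_mem φ hi hc _)

theorem siteMoment_empty : siteMoment φ k σ starred ∅ = 1 := by
  rw [siteMoment_eq, prodFunctional_tprod_eq_prod _ _ ∅, Finset.prod_empty]
  exact fun c _ => booleanExt_colorWord_eq_one φ (by simp)

variable (hY : φ Y = 0) (hY' : φ (star Y) = 0)
include hY hY'

theorem apply_yLetter (i : Fin n) : φ (yLetter starred i) = 0 := by
  rw [yLetter]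
  split_ifs <;> assumption

/-- A site whose active letters contain a color exactly once has vanishing moment, because `φ` is
centered. -/
theorem siteMoment_eq_zero (hi : i ∈ B) (h : ∀ j ∈ B, j ≠ i → k i ≠ k j) :
    siteMoment φ k σ starred B = 0 := by
  rw [siteMoment_eq]
  refine prodFunctional_tprod_eq_zero _ _ (i := k i) ?_
  rw [booleanExt_colorWord_eq φ hi rfl fun j hj hji => h j hj hji.ne,
    colorOp_tail_one, mul_one, apply_yLetter φ hY hY']
  intro j hj hjB
  refine h j hjB ?_
  rintro rfl
  omega

open Classical in
theorem siteMoment_pair (hYY : φ (Y * Y) = 0) (hYYstar : φ (Y * star Y) = 1)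
    (hYstarY : φ (star Y * Y) = 0) (hYstarYstar : φ (star Y * star Y) = 0)
    {i j : Fin n} (hij : i < j) :
    siteMoment φ k σ starred {i, j} = if Contracts k σ starred i j then 1 else 0 := by
  by_cases hk : k i = k j
  · rw [siteMoment_eq, prodFunctional_tprod_eq_prod _ _ {k i}, Finset.prod_singleton,
      booleanExt_colorWord_eq φ (i := i) (by simp) rfl]
    · have hj : ((List.ofFn (colorOp φ k σ starred {i, j} (k i))).drop j).prod 1
          = yLetter starred j := by
        rw [drop_ofFn_eq_cons _ j.2, List.prod_cons, Module.End.mul_apply, colorOp_tail_one,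
          colorOp_of_mem φ (by simp) hk, mul_one]
        intro l hl hl'
        rw [Fin.lt_def] at hij
        simp only [Finset.mem_insert, Finset.mem_singleton, Fin.ext_iff] at hl'
        omega
      rw [colorOp_tail_apply φ (i + 1) hij _ hj]
      · rw [apply_yLetter φ hY hY', zero_smul]
        have hval : φ (yLetter starred i * yLetter starred j)
            = if starred i = false ∧ starred j = true then 1 else 0 := by
          rw [yLetter, yLetter]
          cases starred i <;> cases starred j <;> simp [*]
        have hiff : Contracts k σ starred i j ↔
            (∀ l : Fin n, (i : ℕ) + 1 ≤ l → l < j → k i ∈ σ l) ∧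
              (starred i = false ∧ starred j = true) := by
          simp only [Contracts, hk, true_and, Fin.lt_def, Nat.succ_le_iff]
          tauto
        rw [if_congr hiff rfl rfl]
        split_ifs <;> first | (exfalso; tauto) | simp_all
      · intro l hl hlj
        simp only [Finset.mem_insert, Finset.mem_singleton, not_or]
        refine ⟨?_, hlj.ne⟩
        rintro rfl
        omega
    · intro l hl hli
      simp only [Finset.mem_insert, Finset.mem_singleton] at hl
      rcases hl with rfl | rfl
      · exact absurd hli (lt_irrefl _)
      · exact absurd hli hij.asymm
    · intro c hc
      refine booleanExt_colorWord_eq_one φ fun l hl => ?_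
      simp only [Finset.mem_insert, Finset.mem_singleton] at hl hc
      rcases hl with rfl | rfl
      · exact hc
      · exact hk ▸ hc
  · rw [siteMoment_eq_zero φ hY hY' (i := i) (by simp), if_neg fun h => hk h.2.2.1]
    intro l hl hli
    simp only [Finset.mem_insert, Finset.mem_singleton] at hl
    rcases hl with rfl | rfl
    · exact absurd rfl hli
    · exact hk

end Site

/-! ### Sums over assignments of positions to sites -/

section Assignments
variable {ι : Type*} [Fintype ι] [DecidableEq ι]

/-- The sum over all assignments `l` of sites `l i ∈ I i` to the positions `i ∈ S` of the product of
the weights `f` of the fibers of `l`. Outside `S` the function `l` takes the dummy value `0`. -/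
noncomputable def assignmentSum (f : Finset ι → ℂ) (I : ι → Finset ℕ) (S : Finset ι) : ℂ :=
  ∑ l ∈ Fintype.piFinset (fun i => if i ∈ S then I i else {0}),
    ∏ a ∈ S.image l, f (S.filter fun i => l i = a)

theorem assignmentSum_empty (f : Finset ι → ℂ) (I : ι → Finset ℕ) : assignmentSum f I ∅ = 1 := by
  simp [assignmentSum]

/-- Sorting the assignments by the site `a` of a given position `i₀` and by the set `B` of all
positions which share this site. -/
theorem assignmentSum_eq (f : Finset ι → ℂ) (I : ι → Finset ℕ) {S : Finset ι} {i₀ : ι}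
    (hi₀ : i₀ ∈ S) :
    assignmentSum f I S = ∑ B ∈ S.powerset with i₀ ∈ B, f B *
      ∑ a ∈ (I i₀).filter (fun a => ∀ i ∈ B, a ∈ I i),
        assignmentSum f (fun i => (I i).erase a) (S \ B) := by
  simp only [assignmentSum, Finset.mul_sum]
  simp_rw [Finset.sum_sigma']
  refine Finset.sum_nbij'
    (fun l => ⟨S.filter fun i => l i = l i₀, l i₀, fun i => if i ∈ S ∧ l i ≠ l i₀ then l i else 0⟩)
    (fun x i => if i ∈ x.1 then x.2.1 else x.2.2 i) ?_ ?_ ?_ ?_ ?_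
  · intro l hl
    rw [Fintype.mem_piFinset] at hl
    have hlS : ∀ i ∈ S, l i ∈ I i := fun i hi => by simpa [hi] using hl i
    simp only [Finset.mem_sigma, Finset.mem_filter, Finset.mem_powerset, Finset.filter_subset,
      true_and, hi₀, hlS i₀ hi₀, Fintype.mem_piFinset, Finset.mem_sdiff]
    refine ⟨fun i hi => hi.2 ▸ hlS i hi.1, fun i => ?_⟩
    by_cases hiS : i ∈ S
    · by_cases hli : l i = l i₀
      · simp [hiS, hli]
      · simp [hiS, hli, hlS i hiS]
    · simp [hiS]
  · rintro ⟨B, a, l⟩ hx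
    simp only [Finset.mem_sigma, Finset.mem_filter, Finset.mem_powerset, Fintype.mem_piFinset,
      Finset.mem_sdiff] at hx ⊢
    obtain ⟨⟨hBS, hB⟩, ⟨-, ha⟩, hl⟩ := hx
    intro i
    by_cases hiB : i ∈ B
    · simpa [hiB, hBS hiB] using ha i hiB
    · by_cases hiS : i ∈ S
      · have := hl i
        simp only [hiS, hiB, not_false_eq_true, and_self, if_true, Finset.mem_erase] at this
        simpa [hiB, hiS] using this.2
      · simpa [hiB, hiS] using hl i
  · intro l hl
    rw [Fintype.mem_piFinset] at hl
    funext i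
    by_cases hiS : i ∈ S
    · by_cases hli : l i = l i₀ <;> simp [hiS, hli]
    · have : l i = 0 := by simpa [hiS] using hl i
      simp [hiS, this]
  · rintro ⟨B, a, l⟩ hx
    simp only [Finset.mem_sigma, Finset.mem_filter, Finset.mem_powerset, Fintype.mem_piFinset,
      Finset.mem_sdiff] at hx
    obtain ⟨⟨hBS, hB⟩, -, hl⟩ := hx
    have hne : ∀ i ∈ S, i ∉ B → l i ≠ a := by
      intro i hiS hiB
      have := hl i
      simp only [hiS, hiB, not_false_eq_true, and_self, if_true, Finset.mem_erase] at this
      exact this.1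
    have hout : ∀ i, i ∉ S ∨ i ∈ B → l i = 0 := by
      intro i hi
      have := hl i
      rwa [if_neg (by tauto), Finset.mem_singleton] at this
    have h1 : (S.filter fun i => (if i ∈ B then a else l i) = a) = B := by
      ext i
      rw [Finset.mem_filter]
      constructor
      · rintro ⟨hiS, hi⟩
        by_contra hiB
        rw [if_neg hiB] at hi
        exact hne i hiS hiB hi
      · exact fun hi => ⟨hBS hi, if_pos hi⟩
    have h2 : (fun i => if i ∈ S ∧ (if i ∈ B then a else l i) ≠ a
        then (if i ∈ B then a else l i) else 0) = l := by
      funext i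
      by_cases hiB : i ∈ B
      · simp [hiB, hout i (Or.inr hiB)]
      · by_cases hiS : i ∈ S
        · simp [hiB, hiS, hne i hiS hiB]
        · simp [hiS, hout i (Or.inl hiS)]
    simp only [hB, if_true, h1, h2]
  · intro l hl
    simp only
    have himage : S.image l = insert (l i₀) ((S \ S.filter fun i => l i = l i₀).image
        fun i => if i ∈ S ∧ l i ≠ l i₀ then l i else 0) := by
      ext a
      simp only [Finset.mem_image, Finset.mem_insert, Finset.mem_sdiff, Finset.mem_filter]
      constructor
      · rintro ⟨i, hi, rfl⟩
        by_cases h : l i = l i₀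
        · exact Or.inl h
        · exact Or.inr ⟨i, ⟨hi, by tauto⟩, by simp [hi, h]⟩
      · rintro (rfl | ⟨i, ⟨hi, hi'⟩, rfl⟩)
        · exact ⟨i₀, hi₀, rfl⟩
        · have : l i ≠ l i₀ := by tauto
          exact ⟨i, hi, by simp [hi, this]⟩
    have hnot : l i₀ ∉ (S \ S.filter fun i => l i = l i₀).image
        fun i => if i ∈ S ∧ l i ≠ l i₀ then l i else 0 := by
      simp only [Finset.mem_image, Finset.mem_sdiff, Finset.mem_filter, not_exists, not_and]
      rintro i ⟨hi, hi'⟩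
      have : l i ≠ l i₀ := by tauto
      simp [hi, this]
    rw [himage, Finset.prod_insert hnot]
    congr 1
    refine Finset.prod_congr rfl fun a ha => ?_
    congr 1
    ext i
    simp only [Finset.mem_filter, Finset.mem_sdiff]
    have hane : a ≠ l i₀ := fun h => hnot (h ▸ ha)
    constructor
    · rintro ⟨hi, rfl⟩
      exact ⟨⟨hi, by tauto⟩, by simp [hi, hane]⟩
    · rintro ⟨⟨hi, hi'⟩, h⟩
      have : l i ≠ l i₀ := by tauto
      rw [if_pos ⟨hi, this⟩] at h
      exact ⟨hi, h⟩

end Assignments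

/-! ### Moments of the random walks -/

theorem PhiHat_prod_randomWalk (φ : State YPoly) {n : ℕ} (k : Fin n → ℕ) (σ : Fin n → Set ℕ)
    (starred : Fin n → Bool) (N : ℕ) (s t : Fin n → ℝ) :
    PhiHat φ (List.ofFn fun i => randomWalk N (s i) (t i) (walkLetter k σ starred i)).prod
      = assignmentSum (siteMoment φ k σ starred)
          (fun i => Finset.Ico ⌊s i * N⌋₊ ⌊t i * N⌋₊) Finset.univ := by
  have hwalk : ∀ i, randomWalk N (s i) (t i) (walkLetter k σ starred i)
      = ∑ l ∈ Finset.Ico ⌊s i * N⌋₊ ⌊t i * N⌋₊, siteTensor l (walkLetter k σ starred i) (σ i) := by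
    intro i
    rw [walkLetter, randomWalk]
    split_ifs <;> simp
  simp_rw [hwalk]
  have hexp := (MultilinearMap.mkPiAlgebraFin ℂ n (InfTensor FBialg)).map_sum_finset
    (fun i l => siteTensor l (walkLetter k σ starred i) (σ i))
    (fun i => Finset.Ico ⌊s i * N⌋₊ ⌊t i * N⌋₊)
  simp only [MultilinearMap.mkPiAlgebraFin_apply] at hexp
  rw [hexp, map_sum, assignmentSum]
  simp only [Finset.mem_univ, if_true]
  refine Finset.sum_congr rfl fun l _ => ?_
  simp only [siteTensor]
  rw [prod_ofFn_tprod, PhiHat]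
  have hword : ∀ a, (fun i => Function.update (fun _ => FBialg.P (σ i)) (l i)
      (walkLetter k σ starred i) a)
      = siteWord k σ starred (Finset.univ.filter fun i => l i = a) := by
    intro a
    funext i
    by_cases h : l i = a
    · subst h; simp [siteWord]
    · simp [siteWord, h, Ne.symm h]
  simp_rw [hword]
  refine prodFunctional_tprod_eq_prod _ _ _ fun a ha => ?_
  have : (Finset.univ.filter fun i => l i = a) = ∅ := by
    rw [Finset.filter_eq_empty_iff]
    rintro i - rfl
    exact ha (Finset.mem_image_of_mem _ (Finset.mem_univ i))
  rw [this]
  exact siteMoment_empty φ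

/-! ### Asymptotics of the sums over assignments -/

/-- The filter of the limit `N → ∞` for quantities which depend on `N` and on a set `E` of at most
`r` sites to be avoided: the limit is uniform in `E`. -/
def uniformAtTop (r : ℕ) : Filter (ℕ × Finset ℕ) := atTop ×ˢ 𝓟 {E | E.card ≤ r}

theorem tendsto_fst_uniformAtTop (r : ℕ) : Tendsto Prod.fst (uniformAtTop r) atTop := tendsto_fst

theorem eventually_uniformAtTop {r : ℕ} {p : ℕ × Finset ℕ → Prop} :
    (∀ᶠ x in uniformAtTop r, p x) ↔ ∀ᶠ N in atTop, ∀ E : Finset ℕ, E.card ≤ r → p (N, E) := by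
  rw [uniformAtTop, eventually_prod_principal_iff]
  rfl

/-- Averages over `O(N)` sites of a quantity that tends to zero uniformly tend to zero. -/
theorem tendsto_average_zero {r : ℕ} {g : ℕ × Finset ℕ → ℂ}
    (hg : Tendsto g (uniformAtTop (r + 1)) (𝓝 0)) {J : ℕ × Finset ℕ → Finset ℕ} {C : ℝ}
    (hJ : ∀ x, ((J x).card : ℝ) ≤ C * x.1) :
    Tendsto (fun x => (x.1 : ℂ)⁻¹ * ∑ a ∈ J x, g (x.1, insert a x.2)) (uniformAtTop r) (𝓝 0) := by
  have hC : 0 ≤ C := by simpa using (Nat.cast_nonneg _).trans (hJ (1, ∅))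
  rw [Metric.tendsto_nhds] at hg ⊢
  intro ε hε
  have hδ : 0 < ε / (C + 1) := by positivity
  have h := eventually_uniformAtTop.mp (hg _ hδ)
  rw [eventually_uniformAtTop]
  filter_upwards [h, eventually_gt_atTop 0] with N hN hpos E hE
  have hN0 : (0 : ℝ) < N := Nat.cast_pos.mpr hpos
  rw [dist_zero_right, norm_mul, norm_inv, Complex.norm_natCast]
  have hsum : ‖∑ a ∈ J (N, E), g (N, insert a E)‖ ≤ (J (N, E)).card * (ε / (C + 1)) := by
    refine (norm_sum_le_of_le _ fun a _ => ?_).trans_eq (by rw [Finset.sum_const, nsmul_eq_mul])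
    have := hN (insert a E) ((Finset.card_insert_le _ _).trans (by omega))
    rw [dist_zero_right] at this
    exact this.le
  calc (N : ℝ)⁻¹ * ‖∑ a ∈ J (N, E), g (N, insert a E)‖
      ≤ (N : ℝ)⁻¹ * ((C * N) * (ε / (C + 1))) := by
        gcongr
        exact hsum.trans (by gcongr; exact hJ (N, E))
    _ = C * (ε / (C + 1)) := by field_simp
    _ < (C + 1) * (ε / (C + 1)) := by gcongr; linarith
    _ = ε := by field_simp

section Limit
variable {n : ℕ} (s t : Fin n → ℝ)

/-- The sites at which the random walk `Δ̂^N_{s_i,t_i}` acts. -/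
noncomputable def sites (N : ℕ) (i : Fin n) : Finset ℕ := Finset.Ico ⌊s i * N⌋₊ ⌊t i * N⌋₊

theorem card_sites_le {i : Fin n} (ht : 0 ≤ t i) (N : ℕ) :
    ((sites s t N i).card : ℝ) ≤ t i * N := by
  rw [sites, Nat.card_Ico]
  exact (Nat.cast_le.mpr (Nat.sub_le _ _)).trans (Nat.floor_le (by positivity))

/-- The proportion of the sites common to two walks, up to finitely many, tends to the overlap of
the time intervals. -/
theorem tendsto_card_sites_inter (hs : ∀ i, 0 ≤ s i) (ht : ∀ i, 0 ≤ t i) (i j : Fin n) (r : ℕ) :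
    Tendsto (fun x : ℕ × Finset ℕ =>
        (((sites s t x.1 i ∩ sites s t x.1 j) \ x.2).card : ℝ) / x.1)
      (uniformAtTop r) (𝓝 (overlap s t i j)) := by
  have hfloor : ∀ a : ℝ, 0 ≤ a → Tendsto (fun N : ℕ => (⌊a * N⌋₊ : ℝ) / N) atTop (𝓝 a) :=
    fun a ha => (tendsto_nat_floor_mul_div_atTop ha).comp tendsto_natCast_atTop_atTop
  have hcard : ∀ N : ℕ, ((sites s t N i ∩ sites s t N j).card : ℝ) / N
      = max 0 (min ((⌊t i * N⌋₊ : ℝ) / N) ((⌊t j * N⌋₊ : ℝ) / N)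
          - max ((⌊s i * N⌋₊ : ℝ) / N) ((⌊s j * N⌋₊ : ℝ) / N)) := by
    intro N
    have hN : (0 : ℝ) ≤ N := Nat.cast_nonneg N
    have hsub : ∀ a b : ℕ, ((a - b : ℕ) : ℝ) = max 0 ((a : ℝ) - b) := by
      intro a b
      rcases le_total b a with h | h
      · rw [Nat.cast_sub h, max_eq_right (sub_nonneg.mpr (Nat.cast_le.mpr h))]
      · rw [Nat.sub_eq_zero_of_le h, max_eq_left (sub_nonpos.mpr (Nat.cast_le.mpr h)),
          Nat.cast_zero]
    rw [sites, sites, Finset.Ico_inter_Ico, Nat.card_Ico, hsub, ← max_div_div_right hN,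
      Nat.cast_min, Nat.cast_max, sub_div, zero_div, min_div_div_right hN, max_div_div_right hN]
  have hlim : Tendsto (fun N : ℕ => ((sites s t N i ∩ sites s t N j).card : ℝ) / N) atTop
      (𝓝 (overlap s t i j)) := by
    simp_rw [hcard]
    exact tendsto_const_nhds.max (((hfloor _ (ht i)).min (hfloor _ (ht j))).sub
      ((hfloor _ (hs i)).max (hfloor _ (hs j))))
  have hupper := hlim.comp (tendsto_fst_uniformAtTop r)
  have hlower : Tendsto (fun x : ℕ × Finset ℕ =>
      ((sites s t x.1 i ∩ sites s t x.1 j).card : ℝ) / x.1 - r / x.1) (uniformAtTop r)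
      (𝓝 (overlap s t i j)) := by
    simpa using hupper.sub
      ((tendsto_const_div_atTop_nhds_zero_nat (r : ℝ)).comp (tendsto_fst_uniformAtTop r))
  refine tendsto_of_tendsto_of_tendsto_of_le_of_le' hlower hupper ?_ ?_
  · rw [eventually_uniformAtTop]
    refine Eventually.of_forall fun N E hE => ?_
    rw [← sub_div]
    gcongr
    have := Finset.le_card_sdiff E (sites s t N i ∩ sites s t N j)
    rw [sub_le_iff_le_add]
    have h : (sites s t N i ∩ sites s t N j).card
        ≤ ((sites s t N i ∩ sites s t N j) \ E).card + r := by omega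
    exact_mod_cast h
  · refine Eventually.of_forall fun x => ?_
    simp only [Function.comp_apply]
    gcongr
    exact Finset.sdiff_subset

variable {s t}

/-- Only pairings survive in the limit: if the weight `f` vanishes on singletons, then the rescaled
sums over assignments converge to the function determined by Wick's recursion. In the expansion of
`assignmentSum_eq` the block of a pair leaves an average over `O(N)` sites, and larger blocks carry
a negative power of `N` in addition. -/
theorem tendsto_assignmentSum (hs : ∀ i, 0 ≤ s i) (ht : ∀ i, 0 ≤ t i) {f V : Finset (Fin n) → ℂ}
    (hf : ∀ i, f {i} = 0) (hV0 : V ∅ = 1)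
    (hV : ∀ (S : Finset (Fin n)) (i : Fin n), i ∈ S → (∀ j ∈ S, i ≤ j) →
      V S = ∑ j ∈ S.erase i, f {i, j} * overlap s t i j * V ((S.erase i).erase j))
    (S : Finset (Fin n)) (r : ℕ) :
    Tendsto (fun x : ℕ × Finset ℕ => (((x.1 : ℝ) ^ (-(S.card : ℝ) / 2) : ℝ) : ℂ) *
      assignmentSum f (fun i => sites s t x.1 i \ x.2) S) (uniformAtTop r) (𝓝 (V S)) := by
  induction S using Finset.strongInduction generalizing r with
  | H S ih =>
    rcases S.eq_empty_or_nonempty with rfl | hS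
    · simp only [assignmentSum_empty, hV0]
      simpa using tendsto_const_nhds
    set i := S.min' hS
    have hi : i ∈ S := S.min'_mem hS
    have hmin : ∀ j ∈ S, i ≤ j := fun j hj => S.min'_le j hj
    -- the contribution of the block `B` of `i`
    set term : Finset (Fin n) → ℕ × Finset ℕ → ℂ := fun B x => f B * ((x.1 : ℂ)⁻¹ *
      ∑ a ∈ (sites s t x.1 i \ x.2).filter (fun a => ∀ j ∈ B, a ∈ sites s t x.1 j \ x.2),
        ((((x.1 : ℝ) ^ (-((B.card : ℝ) - 2) / 2) : ℝ) : ℂ) *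
          ((((x.1 : ℝ) ^ (-((S \ B).card : ℝ) / 2) : ℝ) : ℂ) *
            assignmentSum f (fun j => sites s t x.1 j \ insert a x.2) (S \ B)))) with hterm
    set lim : Finset (Fin n) → ℂ := fun B => ∑ j ∈ S.erase i,
      if {i, j} = B then f {i, j} * overlap s t i j * V ((S.erase i).erase j) else 0 with hlim
    have hexpand : ∀ᶠ x in uniformAtTop r, (((x.1 : ℝ) ^ (-(S.card : ℝ) / 2) : ℝ) : ℂ) *
        assignmentSum f (fun i => sites s t x.1 i \ x.2) S
          = ∑ B ∈ S.powerset with i ∈ B, term B x := by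
      filter_upwards [(tendsto_fst_uniformAtTop r).eventually (eventually_gt_atTop 0)] with x hx
      have hx0 : (0 : ℝ) < x.1 := Nat.cast_pos.mpr hx
      rw [assignmentSum_eq f _ hi, Finset.mul_sum]
      refine Finset.sum_congr rfl fun B hB => ?_
      have hBS : B ⊆ S := by simpa using (Finset.mem_filter.mp hB).1
      have hpow : (x.1 : ℝ) ^ (-(S.card : ℝ) / 2) = (x.1 : ℝ)⁻¹ *
          ((x.1 : ℝ) ^ (-((B.card : ℝ) - 2) / 2) * (x.1 : ℝ) ^ (-((S \ B).card : ℝ) / 2)) := by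
        rw [← Real.rpow_neg_one, ← Real.rpow_add hx0, ← Real.rpow_add hx0]
        congr 1
        rw [Finset.card_sdiff_of_subset hBS, Nat.cast_sub (Finset.card_le_card hBS)]
        ring
      rw [hpow]
      simp only [hterm, Finset.mul_sum, Finset.sdiff_insert]
      refine Finset.sum_congr (by congr) fun a _ => ?_
      push_cast
      ring
    have hlimit : ∀ B ∈ S.powerset.filter (i ∈ ·),
        Tendsto (term B) (uniformAtTop r) (𝓝 (lim B)) := by
      intro B hB
      rw [Finset.mem_filter, Finset.mem_powerset] at hB
      obtain ⟨hBS, hiB⟩ := hB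
      have hlt : S \ B ⊂ S := Finset.sdiff_ssubset hBS ⟨i, hiB⟩
      have hpos : 0 < B.card := Finset.card_pos.mpr ⟨i, hiB⟩
      have hpair : ∀ j ∈ S.erase i, ({i, j} : Finset (Fin n)).card = 2 := fun j hj =>
        Finset.card_pair (Finset.ne_of_mem_erase hj).symm
      have hlim0 : B.card ≠ 2 → lim B = 0 := fun h => Finset.sum_eq_zero fun j hj =>
        if_neg fun he => h (by rw [← he]; exact hpair j hj)
      have hbound : ∀ x : ℕ × Finset ℕ, (((sites s t x.1 i \ x.2).filter
          (fun a => ∀ j ∈ B, a ∈ sites s t x.1 j \ x.2)).card : ℝ) ≤ t i * x.1 := fun x =>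
        (Nat.cast_le.mpr (Finset.card_le_card ((Finset.filter_subset _ _).trans
          Finset.sdiff_subset))).trans (card_sites_le s t (ht i) x.1)
      obtain h1 | h2 | h3 : B.card = 1 ∨ B.card = 2 ∨ 2 < B.card := by omega
      · obtain ⟨b, rfl⟩ := Finset.card_eq_one.mp h1
        rw [hlim0 (by omega)]
        simp only [hterm, hf, zero_mul]
        exact tendsto_const_nhds
      · obtain ⟨j, hj, rfl⟩ : ∃ j ∈ S.erase i, {i, j} = B := by
          obtain ⟨j, hj⟩ := Finset.card_eq_one.mp
            (show (B.erase i).card = 1 by rw [Finset.card_erase_of_mem hiB, h2])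
          have hjB : j ∈ B.erase i := by rw [hj]; simp
          exact ⟨j, Finset.erase_subset_erase _ hBS hjB, by rw [← hj, Finset.insert_erase hiB]⟩
        have hSB : S \ {i, j} = (S.erase i).erase j := by
          ext l
          simp only [Finset.mem_sdiff, Finset.mem_insert, Finset.mem_singleton, Finset.mem_erase]
          tauto
        have hval : lim {i, j} = f {i, j} * (overlap s t i j * V (S \ {i, j})) := by
          rw [hSB, ← mul_assoc]
          simp only [hlim]
          rw [Finset.sum_eq_single_of_mem j hj, if_pos rfl]
          intro l hl hlj
          refine if_neg fun he => hlj ?_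
          have : l ∈ ({i, j} : Finset (Fin n)) := he ▸ by simp
          simpa [Finset.ne_of_mem_erase hl] using this
        rw [hval]
        refine Tendsto.const_mul _ ?_
        have hzero := tendsto_average_zero
          (tendsto_sub_nhds_zero_iff.mpr (ih _ hlt (r + 1))) hbound
        have hcount : Tendsto (fun x : ℕ × Finset ℕ => (x.1 : ℂ)⁻¹ *
            (((sites s t x.1 i \ x.2).filter
              (fun a => ∀ l ∈ ({i, j} : Finset (Fin n)), a ∈ sites s t x.1 l \ x.2)).card
                * V (S \ {i, j})))
            (uniformAtTop r) (𝓝 (overlap s t i j * V (S \ {i, j}))) := by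
          have h := ((Complex.continuous_ofReal.tendsto _).comp
            (tendsto_card_sites_inter s t hs ht i j r)).mul_const (V (S \ {i, j}))
          refine h.congr fun x => ?_
          have : (sites s t x.1 i \ x.2).filter
              (fun a => ∀ l ∈ ({i, j} : Finset (Fin n)), a ∈ sites s t x.1 l \ x.2)
              = (sites s t x.1 i ∩ sites s t x.1 j) \ x.2 := by
            ext a
            simp only [Finset.mem_filter, Finset.mem_sdiff, Finset.mem_inter, Finset.mem_insert,
              Finset.mem_singleton, forall_eq_or_imp, forall_eq]
            tauto
          rw [this]
          simp only [Function.comp_apply]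
          push_cast
          ring
        have hadd := hzero.add hcount
        rw [zero_add] at hadd
        refine hadd.congr fun x => ?_
        rw [← mul_add, Finset.sum_sub_distrib, Finset.sum_const, nsmul_eq_mul, sub_add_cancel]
        simp only [h2]
        simp
      · rw [hlim0 (by omega), ← mul_zero (f B)]
        refine Tendsto.const_mul _ ?_
        have hexp : 0 < ((B.card : ℝ) - 2) / 2 := by
          have : (2 : ℝ) < B.card := by exact_mod_cast h3
          linarith
        have hpow : Tendsto (fun x : ℕ × Finset ℕ =>
            (((x.1 : ℝ) ^ (-((B.card : ℝ) - 2) / 2) : ℝ) : ℂ)) (uniformAtTop (r + 1)) (𝓝 0) := by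
          have h := (tendsto_rpow_neg_atTop hexp).comp
            (tendsto_natCast_atTop_atTop.comp (tendsto_fst_uniformAtTop (r + 1)))
          have h' := (Complex.continuous_ofReal.tendsto _).comp h
          simp only [neg_div]
          simpa [Function.comp_def] using h'
        have hmul := hpow.mul (ih _ hlt (r + 1))
        rw [zero_mul] at hmul
        exact tendsto_average_zero hmul hbound
    have hsum := tendsto_finsetSum _ hlimit
    have hVS : ∑ B ∈ S.powerset with i ∈ B, lim B = V S := by
      rw [hV S i hi hmin]
      simp only [hlim]
      rw [Finset.sum_comm]
      refine Finset.sum_congr rfl fun j hj => ?_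
      rw [Finset.sum_ite_eq, if_pos]
      rw [Finset.mem_filter, Finset.mem_powerset, Finset.insert_subset_iff,
        Finset.singleton_subset_iff]
      exact ⟨⟨hi, Finset.mem_of_mem_erase hj⟩, by simp⟩
    rw [hVS] at hsum
    exact hsum.congr' (hexpand.mono fun x hx => hx.symm)

end Limit

end Filtered

open Filtered in
theorem theorem7p1 {G : Type*} [NormedAddCommGroup G] [InnerProductSpace ℂ G] [CompleteSpace G]
    (e : HilbertBasis ℕ ℂ G)
    (φ : State YPoly) (hY : φ Y = 0)
    (hYY : φ (Y * Y) = 0) (hYYstar : φ (Y * star Y) = 1)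
    (hYstarY : φ (star Y * Y) = 0) (hYstarYstar : φ (star Y * star Y) = 0)
    (n : ℕ) (k : Fin n → ℕ) (σ : Fin n → Set ℕ)
    (s t : Fin n → ℝ) (hs : ∀ i, 0 ≤ s i) (hst : ∀ i, s i ≤ t i)
    (starred : Fin n → Bool) :
    Filter.Tendsto
      (fun N : ℕ => (((N : ℝ) ^ (-(n : ℝ) / 2) : ℝ) : ℂ) *
        PhiHat φ (List.ofFn fun i => randomWalk N (s i) (t i)
          (if starred i then star (FBialg.X (k i) (σ i)) else FBialg.X (k i) (σ i))).prod)
      Filter.atTop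
      (nhds (vacuumExpectation (List.ofFn fun i =>
        if starred i then filteredCreate e (σ i) (tens (chi (s i) (t i)) (e (k i)))
        else filteredAnn e (σ i) (tens (chi (s i) (t i)) (e (k i)))).prod)) := by
  classical
  have hY' := φ.apply_star_Y_eq_zero hY hYstarY
  have hmain := tendsto_assignmentSum hs (fun i => (hs i).trans (hst i))
    (f := siteMoment φ k σ starred) (V := fockMoment e k σ s t starred)
    (fun i => siteMoment_eq_zero φ hY hY' (Finset.mem_singleton_self i)
      fun j hj hji => absurd (Finset.mem_singleton.mp hj) hji)
    (fockMoment_empty e k σ s t starred)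
    (fun S i hi hmin => by
      rw [fockMoment_eq_sum e k σ s t starred hs hi hmin]
      refine Finset.sum_congr rfl fun j hj => ?_
      have hij : i < j := lt_of_le_of_ne (hmin j (Finset.mem_of_mem_erase hj))
        (Finset.ne_of_mem_erase hj).symm
      rw [siteMoment_pair φ hY hY' hYY hYYstar hYstarY hYstarYstar hij]
      split_ifs <;> simp)
    Finset.univ 0
  -- no site has to be avoided
  have hempty : Tendsto (fun N : ℕ => (N, (∅ : Finset ℕ))) atTop (uniformAtTop 0) :=
    tendsto_id.prodMk (tendsto_principal.mpr (by simp))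
  have hlim := hmain.comp hempty
  have hvac : vacuumExpectation (List.ofFn fun i =>
        if starred i then filteredCreate e (σ i) (tens (chi (s i) (t i)) (e (k i)))
        else filteredAnn e (σ i) (tens (chi (s i) (t i)) (e (k i)))).prod
      = fockMoment e k σ s t starred Finset.univ := by
    rw [vacuumExpectation_eq, fockMoment, fockWord, Finset.piecewise_univ]
    rfl
  rw [hvac]
  refine hlim.congr fun N => ?_
  simp only [Function.comp_apply, Finset.card_univ, Fintype.card_fin, Finset.sdiff_empty]
  congr 1
  exact (PhiHat_prod_randomWalk φ k σ starred N s t).symm
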